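/- **Setting.** Let $N\ge 4$ and let $m$ be an integer with $2\le m\le N/2$ and $N-2m\ne 1$. Write $\mathbb R^N=\mathbb R^m\times\mathbb R^m\times\mathbb R^{N-2m}$, $x=(x_1,x_2,x_3)$, let $\tau(x_1,x_2,x_3)=(x_2,x_1,x_3)$, and let $\mathbf G=O(m)\times O(m)\times O(N-2m)$ act blockwise on $\mathbb R^N$. Let $\mathbf Y_{\mathbf G}$ be the closed subspace of all real $v\in H^1(\mathbb R^N)$ such that $v(gx)=v(x)$ for all $g\in\mathbf G$ and $v(\tau x)=-v(x)$, for a.e. $x$. Let $f:\mathbb R\to\mathbb R$ be the odd function with $f'=1/\sqrt{1+2f^2}$, and for $\lambda>0$ put $$\mathbb Y_\lambda=\Big\{v\in\mathbf Y_{\mathbf G}:\ \int_{\mathbb R^N}f(v)^2\,dx=\lambda\Big\},$$ a $C^1$ hypersurface of $\mathbf Y_{\mathbf G}$. Tangent vectors of $\mathbb Y_\lambda$ at $v$ are the velocities at time $0$ of $C^1$ curves in $\mathbb Y_\lambda$ through $v$. For $I\in C^1(\mathbb Y_\lambda,\mathbb R)$ let $I'|_{\mathbb Y_\lambda}(v)$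 be its differential on the tangent space at $v$, measured in the norm dual to the $H^1$ norm, and let $K_c=\{v\in\mathbb Y_\lambda: I(v)=c,\ I'|_{\mathbb Y_\lambda}(v)=0\}$; $c$ is a critical value if $K_c\neq\emptyset$. The condition $(PS)_c$ says that every sequence $(v_n)$ in $\mathbb Y_\lambda$ with $I(v_n)\to c$ and $\|I'|_{\mathbb Y_\lambda}(v_n)\|\to0$ has a subsequence that converges in $\mathbb Y_\lambda$. For a symmetric set $E=-E$ the genus $\gamma(E)\in\{0,1,2,\dots,\infty\}$ is the least $n$ such that there is a continuous odd map $E\to\mathbb R^n\setminus\{0\}$ ($\infty$ if there is none; $\gamma(\emptyset)=0$). Let $\Gamma_k$ be the family of all closed symmetric $E\subset\mathbb Y_\lambda$ with $\gamma(E)\ge k$, and put $$c_k=\inf_{E\in\Gamma_k}\ \sup_{v\in E}I(v)\in[-\infty,\infty],\qquad k\ge1.$$ **Theorem 3.2.** Let $I\in C^1(\mathbb Y_\lambda,\mathbb R)$ be even and bounded from below, suppose that $I$ satisfies $(PS)_c$ for every $c<0$, and that $\Gamma_k\ne\emptyset$ for every $k\ge1$. Then: (i) $-\infty<c_1\le c_2\le\cdots\le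 c_k\le\cdots$. If $k\geq 1$ and $c_k<0$, then $c_k$ is a critical value of $I|_{\mathbb Y_\lambda}$, and $c_1\le\cdots\le c_k<0$. (ii) If $k,l\ge1$ and $c_k=c_{k+1}=\cdots=c_{k+l-1}=c<0$, then $\gamma(K_c)\ge l$. If moreover $l\ge2$, then $K_c$ is infinite. (iii) If $c_k<0$ for all $k\ge1$, then $c_k\to0^-$ as $k\to\infty$. -/

import Mathlib

open MeasureTheory Set Filter Topology
open scoped ContDiff ENNReal

noncomputable section

namespace NonradialQLS

/-! ## The dual change of variables `f` -/

/-- The inverse of the change of variables: `s ↦ ∫₀ˢ √(1 + 2x²) dx`. -/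
def dualInv (s : ℝ) : ℝ := ∫ x in (0 : ℝ)..s, Real.sqrt (1 + 2 * x ^ 2)

theorem dualInv_hasDerivAt (s : ℝ) : HasDerivAt dualInv (Real.sqrt (1 + 2 * s ^ 2)) s := by
  have hc : Continuous fun x : ℝ => Real.sqrt (1 + 2 * x ^ 2) := by fun_prop
  exact intervalIntegral.integral_hasDerivAt_right (hc.intervalIntegrable _ _)
    (hc.stronglyMeasurableAtFilter _ _) hc.continuousAt

theorem sqrt_one_add_pos (s : ℝ) : 0 < Real.sqrt (1 + 2 * s ^ 2) :=
  Real.sqrt_pos.2 (by positivity)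

theorem dualInv_strictMono : StrictMono dualInv :=
  strictMono_of_deriv_pos fun s => by
    rw [(dualInv_hasDerivAt s).deriv]; exact sqrt_one_add_pos s

theorem dualInv_neg (s : ℝ) : dualInv (-s) = -dualInv s := by
  have h := intervalIntegral.integral_comp_neg (a := 0) (b := s)
    (fun x : ℝ => Real.sqrt (1 + 2 * x ^ 2))
  simp only [even_two, Even.neg_pow, neg_zero] at h
  rw [dualInv, dualInv, h, intervalIntegral.integral_symm]

theorem dualInv_surjective : Function.Surjective dualInv := by
  have hcont : Continuous dualInv :=
    continuous_iff_continuousAt.2 fun s => (dualInv_hasDerivAt s).continuousAt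
  have hmono : Monotone fun s => dualInv s - s := by
    have hd : ∀ s, HasDerivAt (fun s => dualInv s - s) (Real.sqrt (1 + 2 * s ^ 2) - 1) s :=
      fun s => (dualInv_hasDerivAt s).sub (hasDerivAt_id s)
    refine monotone_of_deriv_nonneg (fun s => (hd s).differentiableAt) fun s => ?_
    rw [(hd s).deriv, sub_nonneg]
    exact Real.one_le_sqrt.2 (by nlinarith [sq_nonneg s])
  have h0 : dualInv 0 = 0 := by simp [dualInv]
  refine hcont.surjective ?_ ?_
  · refine tendsto_atTop_mono' _ ?_ tendsto_id
    filter_upwards [eventually_ge_atTop 0] with s hs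
    have := hmono hs
    simp only [h0] at this
    simp only [id]; linarith
  · refine tendsto_atBot_mono' _ ?_ tendsto_id
    filter_upwards [eventually_le_atBot 0] with s hs
    have := hmono hs
    simp only [h0] at this
    simp only [id]; linarith

/-- `dualInv` as an increasing bijection of the real line. -/
def dualIso : ℝ ≃o ℝ := dualInv_strictMono.orderIsoOfSurjective _ dualInv_surjective

/-- The dual function `f`: the odd function with `f' = 1 / √(1 + 2 f²)`
(see `dualF_hasDerivAt` and `dualF_neg`). -/
def dualF (t : ℝ) : ℝ := dualIso.symm t

theorem dualInv_dualF (t : ℝ) : dualInv (dualF t) = t := dualIso.apply_symm_apply t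

/-- The differential equation that defines `f`. -/
theorem dualF_hasDerivAt (t : ℝ) :
    HasDerivAt dualF (1 / Real.sqrt (1 + 2 * dualF t ^ 2)) t := by
  rw [one_div]
  exact (dualInv_hasDerivAt (dualF t)).of_local_left_inverse
    dualIso.symm.continuous.continuousAt (sqrt_one_add_pos _).ne'
    (Eventually.of_forall dualInv_dualF)

/-- `f` is odd. -/
theorem dualF_neg (t : ℝ) : dualF (-t) = -dualF t := by
  apply dualInv_strictMono.injective
  rw [dualInv_neg, dualInv_dualF, dualInv_dualF]

/-! ## The Sobolev space `H¹` -/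

section Sobolev

variable (E : Type*) [NormedAddCommGroup E] [InnerProductSpace ℝ E] [FiniteDimensional ℝ E]
  [MeasurableSpace E] [BorelSpace E]

/-- The real Sobolev space `H¹(E)`. An element is a pair `(u, g)` in `L²(E; ℝ) × L²(E; E)` such
that `g` is the weak gradient of `u`. As `g` is determined by `u`, this is the space of all `u` in
`L²` with weak gradient in `L²`; it carries the norm `(‖u‖₂² + ‖∇u‖₂²)^(1/2)`. -/
def H1 : Submodule ℝ (WithLp 2 (Lp ℝ 2 (volume : Measure E) × Lp E 2 (volume : Measure E))) where
  carrier := {w | ∀ φ : E → ℝ, ContDiff ℝ ∞ φ → HasCompactSupport φ → ∀ e : E,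
    ∫ x, w.fst x * fderiv ℝ φ x e = -∫ x, inner ℝ (w.snd x) e * φ x}
  zero_mem' := by
    intro φ _ _ e
    have h1 : (fun x => (0 : Lp ℝ 2 (volume : Measure E)) x * fderiv ℝ φ x e) =ᵐ[volume] 0 := by
      filter_upwards with x
      simp
    have h2 : (fun x => inner ℝ ((0 : Lp E 2 (volume : Measure E)) x) e * φ x) =ᵐ[volume] 0 := by
      filter_upwards with x
      simp
    have e1 := integral_congr_ae h1
    have e2 := integral_congr_ae h2
    simp only [WithLp.zero_fst, WithLp.zero_snd]
    rw [e1, e2]; simp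
  add_mem' := by
    intro v w hv hw φ hφ hc e
    have hφ2 : MemLp φ 2 (volume : Measure E) := hφ.continuous.memLp_of_hasCompactSupport hc
    have hd2 : MemLp (fun x => fderiv ℝ φ x e) 2 (volume : Measure E) :=
      ((hφ.continuous_fderiv (by simp)).clm_apply continuous_const).memLp_of_hasCompactSupport
        (hc.fderiv_apply (𝕜 := ℝ) e)
    have i1 : ∀ u : Lp ℝ 2 (volume : Measure E), Integrable fun x => u x * fderiv ℝ φ x e :=
      fun u => (Lp.memLp u).integrable_mul hd2
    have i2 : ∀ g : Lp E 2 (volume : Measure E), Integrable fun x => inner ℝ (g x) e * φ x :=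
      fun g => ((Lp.memLp g).inner_const e).integrable_mul hφ2
    have h1 : (fun x => (v.fst + w.fst) x * fderiv ℝ φ x e) =ᵐ[volume]
        fun x => v.fst x * fderiv ℝ φ x e + w.fst x * fderiv ℝ φ x e := by
      filter_upwards [Lp.coeFn_add v.fst w.fst] with x hx
      rw [hx, Pi.add_apply, add_mul]
    have h2 : (fun x => inner ℝ ((v.snd + w.snd) x) e * φ x) =ᵐ[volume]
        fun x => inner ℝ (v.snd x) e * φ x + inner ℝ (w.snd x) e * φ x := by
      filter_upwards [Lp.coeFn_add v.snd w.snd] with x hx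
      rw [hx, Pi.add_apply, inner_add_left, add_mul]
    have := hv φ hφ hc e
    have := hw φ hφ hc e
    simp only [WithLp.add_fst, WithLp.add_snd]
    rw [integral_congr_ae h1, integral_congr_ae h2, integral_add (i1 _) (i1 _),
      integral_add (i2 _) (i2 _)]
    linarith
  smul_mem' := by
    intro c w hw φ hφ hc e
    have h1 : (fun x => (c • w.fst) x * fderiv ℝ φ x e) =ᵐ[volume]
        fun x => c * (w.fst x * fderiv ℝ φ x e) := by
      filter_upwards [Lp.coeFn_smul c w.fst] with x hx
      rw [hx, Pi.smul_apply, smul_eq_mul, mul_assoc]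
    have h2 : (fun x => inner ℝ ((c • w.snd) x) e * φ x) =ᵐ[volume]
        fun x => c * (inner ℝ (w.snd x) e * φ x) := by
      filter_upwards [Lp.coeFn_smul c w.snd] with x hx
      rw [hx, Pi.smul_apply, real_inner_smul_left, mul_assoc]
    have := hw φ hφ hc e
    simp only [WithLp.smul_fst, WithLp.smul_snd]
    rw [integral_congr_ae h1, integral_congr_ae h2, integral_const_mul, integral_const_mul, this]
    ring

variable {E}

/-- The underlying function (defined almost everywhere) of an element of `H¹`. -/
def H1.toFun (w : H1 E) : E → ℝ := (w.1.fst : E → ℝ)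

theorem H1.toFun_zero : ∀ᵐ x : E, H1.toFun (0 : H1 E) x = 0 :=
  Lp.coeFn_zero ℝ 2 (volume : Measure E)

theorem H1.toFun_add (v w : H1 E) :
    ∀ᵐ x : E, H1.toFun (v + w) x = H1.toFun v x + H1.toFun w x :=
  Lp.coeFn_add v.1.fst w.1.fst

theorem H1.toFun_smul (c : ℝ) (v : H1 E) :
    ∀ᵐ x : E, H1.toFun (c • v) x = c * H1.toFun v x :=
  Lp.coeFn_smul c v.1.fst

/-- The closed subspace of all `v` in `H¹` with `v (g x) = s * v x` for almost every `x`. -/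
def H1.equivariant (g : E ≃ₗᵢ[ℝ] E) (s : ℝ) : Submodule ℝ (H1 E) where
  carrier := {v | ∀ᵐ x : E, H1.toFun v (g x) = s * H1.toFun v x}
  zero_mem' := by
    have h := H1.toFun_zero (E := E)
    have hg := g.measurePreserving.quasiMeasurePreserving.ae h
    filter_upwards [h, hg] with x h1 h2
    rw [h1, h2, mul_zero]
  add_mem' := by
    intro v w hv hw
    have h := H1.toFun_add v w
    have hg := g.measurePreserving.quasiMeasurePreserving.ae h
    change ∀ᵐ x : E, H1.toFun (v + w) (g x) = s * H1.toFun (v + w) x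
    filter_upwards [h, hg, hv, hw] with x h1 h2 h3 h4
    rw [h1, h2, h3, h4, mul_add]
  smul_mem' := by
    intro c v hv
    have h := H1.toFun_smul c v
    have hg := g.measurePreserving.quasiMeasurePreserving.ae h
    change ∀ᵐ x : E, H1.toFun (c • v) (g x) = s * H1.toFun (c • v) x
    filter_upwards [h, hg, hv] with x h1 h2 h3
    rw [h1, h2, h3, mul_left_comm]

theorem H1.mem_equivariant {g : E ≃ₗᵢ[ℝ] E} {s : ℝ} {v : H1 E} :
    v ∈ H1.equivariant g s ↔ ∀ᵐ x : E, H1.toFun v (g x) = s * H1.toFun v x := Iff.rfl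

end Sobolev

/-! ## The symmetric workspace -/

/-- `ℝᴺ = ℝᵐ × ℝᵐ × ℝᴺ⁻²ᵐ` with the Euclidean norm (for `2m ≤ N`). -/
abbrev RN (N m : ℕ) : Type := EuclideanSpace ℝ (Fin m ⊕ Fin m ⊕ Fin (N - 2 * m))

/-- Exchange of the first two blocks of coordinate indices. -/
def swapIdx (N m : ℕ) :
    (Fin m ⊕ Fin m ⊕ Fin (N - 2 * m)) ≃ (Fin m ⊕ Fin m ⊕ Fin (N - 2 * m)) where
  toFun
    | .inl i => .inr (.inl i)
    | .inr (.inl i) => .inl i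
    | .inr (.inr j) => .inr (.inr j)
  invFun
    | .inl i => .inr (.inl i)
    | .inr (.inl i) => .inl i
    | .inr (.inr j) => .inr (.inr j)
  left_inv := by rintro (i | i | j) <;> rfl
  right_inv := by rintro (i | i | j) <;> rfl

/-- The orthogonal map `τ (x₁, x₂, x₃) = (x₂, x₁, x₃)`. -/
def tau (N m : ℕ) : RN N m ≃ₗᵢ[ℝ] RN N m :=
  LinearIsometryEquiv.piLpCongrLeft 2 ℝ ℝ (swapIdx N m)

theorem tau_apply (N m : ℕ) (x : RN N m) :
    (∀ i, tau N m x (.inl i) = x (.inr (.inl i))) ∧ (∀ i, tau N m x (.inr (.inl i)) = x (.inl i)) ∧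
      ∀ j, tau N m x (.inr (.inr j)) = x (.inr (.inr j)) :=
  ⟨fun _ => rfl, fun _ => rfl, fun _ => rfl⟩

/-- The group `𝐆 = O(m) × O(m) × O(N - 2m)` acting on `ℝᴺ` by
`(x₁, x₂, x₃) ↦ (A x₁, B x₂, C x₃)`. -/
def symGroup (N m : ℕ) : Set (RN N m ≃ₗᵢ[ℝ] RN N m) :=
  {g | ∃ A ∈ Matrix.orthogonalGroup (Fin m) ℝ, ∃ B ∈ Matrix.orthogonalGroup (Fin m) ℝ,
    ∃ C ∈ Matrix.orthogonalGroup (Fin (N - 2 * m)) ℝ, ∀ x : RN N m,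
      (∀ i, g x (.inl i) = A.mulVec (fun j => x (.inl j)) i) ∧
      (∀ i, g x (.inr (.inl i)) = B.mulVec (fun j => x (.inr (.inl j))) i) ∧
      (∀ i, g x (.inr (.inr i)) = C.mulVec (fun j => x (.inr (.inr j))) i)}

/-- The Hilbert space `𝐘_𝐆`: all `v` in `H¹(ℝᴺ)` that are `𝐆`-invariant, `v (g x) = v x` for all
`g` in `𝐆`, and satisfy `v (τ x) = - v x` (see `mem_YG`). -/
def YG (N m : ℕ) : Submodule ℝ (H1 (RN N m)) :=
  (⨅ g ∈ symGroup N m, H1.equivariant g 1) ⊓ H1.equivariant (tau N m) (-1)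

theorem mem_YG {N m : ℕ} {v : H1 (RN N m)} :
    v ∈ YG N m ↔ (∀ g ∈ symGroup N m, ∀ᵐ x, H1.toFun v (g x) = H1.toFun v x) ∧
      ∀ᵐ x, H1.toFun v (tau N m x) = -H1.toFun v x := by
  rw [YG, Submodule.mem_inf]
  simp only [Submodule.mem_iInf, H1.mem_equivariant, one_mul, neg_one_mul]

/-- The constraint set `𝕐_λ = {v ∈ 𝐘_𝐆 : ‖f(v)‖₂² = λ}`. -/
def Ycon (N m : ℕ) (lam : ℝ) : Set (YG N m) :=
  {v | ∫ x, dualF (H1.toFun (v : H1 (RN N m)) x) ^ 2 = lam}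

/-! ## Calculus and critical points on a constraint set -/

section Constraint

variable {X : Type*} [NormedAddCommGroup X] [NormedSpace ℝ X]

/-- `I` is of class `C¹` on `M`: near each point of `M` it is the restriction to `M` of a `C¹`
function defined on an open subset of the ambient space. Only the values of `I` on `M` matter. -/
def IsC1On (M : Set X) (I : X → ℝ) : Prop :=
  ∀ v ∈ M, ∃ U : Set X, IsOpen U ∧ v ∈ U ∧ ∃ F : X → ℝ, ContDiffOn ℝ 1 F U ∧ EqOn F I (U ∩ M)

/-- `γ` is a `C¹` curve in `M`, defined near time `0`, with `γ 0 = v`. Its velocity `γ' 0` is a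
tangent vector of `M` at `v`, and every tangent vector arises in this way. -/
def IsCurveThrough (M : Set X) (v : X) (γ : ℝ → X) : Prop :=
  γ 0 = v ∧ ∃ ε > 0, ContDiffOn ℝ 1 γ (Ioo (-ε) ε) ∧ ∀ t ∈ Ioo (-ε) ε, γ t ∈ M

/-- The norm of the differential of `I|_M` at `v`, as a linear functional on the tangent space of
`M` at `v` with the ambient norm. The differential sends the tangent vector `γ' 0` to
`(I ∘ γ)' 0`. -/
def diffNorm (M : Set X) (I : X → ℝ) (v : X) : ℝ≥0∞ :=
  ⨆ (γ : ℝ → X) (_ : IsCurveThrough M v γ ∧ ‖deriv γ 0‖ ≤ 1),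
    ENNReal.ofReal |deriv (fun t => I (γ t)) 0|

/-- `v` is a critical point of `I|_M`: the differential of `I|_M` at `v` vanishes. -/
def IsCritPt (M : Set X) (I : X → ℝ) (v : X) : Prop :=
  v ∈ M ∧ ∀ γ : ℝ → X, IsCurveThrough M v γ → HasDerivAt (fun t => I (γ t)) 0 0

/-- The set `K_c` of critical points of `I|_M` at level `c`. -/
def critSet (M : Set X) (I : X → ℝ) (c : ℝ) : Set X := {v | IsCritPt M I v ∧ I v = c}

/-- `c` is a critical value of `I|_M`. -/
def IsCritValue (M : Set X) (I : X → ℝ) (c : ℝ) : Prop := (critSet M I c).Nonempty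

/-- The Palais-Smale condition `(PS)_c` for `I|_M`: every sequence in `M` with `I → c` and
`‖(I|_M)'‖ → 0` has a subsequence that converges in `M`. -/
def PalaisSmale (M : Set X) (I : X → ℝ) (c : ℝ) : Prop :=
  ∀ v : ℕ → X, (∀ n, v n ∈ M) → Tendsto (fun n => I (v n)) atTop (𝓝 c) →
    Tendsto (fun n => diffNorm M I (v n)) atTop (𝓝 0) →
    ∃ w ∈ M, ∃ s : ℕ → ℕ, StrictMono s ∧ Tendsto (fun n => v (s n)) atTop (𝓝 w)

/-! ## Genus and minimax values -/

/-- The Krasnoselskii genus of `E`: the least `n` such that there is a continuous odd map from `E`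
to `ℝⁿ \ {0}`, and `∞` if there is no such `n`. The genus of the empty set is `0`. -/
def genus (E : Set X) : ℕ∞ :=
  ⨅ (n : ℕ) (_ : ∃ ψ : X → EuclideanSpace ℝ (Fin n),
    ContinuousOn ψ E ∧ ∀ x ∈ E, ψ (-x) = -ψ x ∧ ψ x ≠ 0), (n : ℕ∞)

/-- The family `Σ(M)` of all subsets of `M` that are closed in `M` and symmetric, `E = -E`. -/
def symClosed (M : Set X) : Set (Set X) :=
  {E | E ⊆ M ∧ IsClosed ((↑) ⁻¹' E : Set M) ∧ ∀ x ∈ E, -x ∈ E}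

/-- The family `Γ_k` of all `E` in `Σ(M)` with genus at least `k`. -/
def genusFamily (M : Set X) (k : ℕ) : Set (Set X) := {E | E ∈ symClosed M ∧ (k : ℕ∞) ≤ genus E}

/-- The minimax value `c_k = inf_{E ∈ Γ_k} sup_{v ∈ E} I(v)`, an extended real number. -/
def minimaxValue (M : Set X) (I : X → ℝ) (k : ℕ) : EReal :=
  ⨅ E ∈ genusFamily M k, ⨆ v ∈ E, (I v : EReal)

end Constraint

end NonradialQLS

end

/-! This is the Lusternik-Schnirelmann scheme on the hypersurface `J = lam`, where `J` is the
functional `∫ f(v)²`. Since `(f²)'(t) t > 0` for `t ≠ 0`, `J` increases strictly along rays. The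
implicit function theorem then makes the radial projection onto the level set a C¹ odd retraction
near it, and extending `I` constantly along rays turns tangential calculus into calculus in a
Hilbert space.

Everything rests on one quantitative statement, `exists_minimaxValue_gap`: if `K_r` has genus at
most `p`, then `c_k > r - ε` forces `c_{k+p} ≥ r + ε`. Indeed, suppose that a set `E` in `Γ_{k+p}`
lies below `r + ε`. By `(PS)_r` the differential is bounded below near the level `r` and away from
`K_r`, so `E` minus a neighbourhood of `K_r` can be pushed oddly below `r - ε`, where the genus is
at most `k - 1`. By compactness of `K_r` the neighbourhood can be taken of genus at most `p`, and
subadditivity gives genus at most `k - 1 + p` for `E`, which is absurd.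

With `p = l - 1` the gap yields the multiplicity statement, and with `l = 1` the existence of
critical points. A negative limit `r` of the `c_k` is impossible because the compact set `K_r` has
some finite genus `p`, so the values would jump past `r`.

The gradient of `I` is merely continuous, so no flow is available. The deformation
`exists_odd_deformation` is instead a limit of iterated small steps, whose lengths are chosen
continuously. -/

noncomputable section

namespace NonradialQLS

open scoped NNReal

/-! ### Odd deformations by iterated descent steps. -/

section Deformation

variable {X : Type*} [NormedAddCommGroup X]

/-- The radii `r ∈ [0, 1]` such that `G w s` holds for all `w ∈ M` in the open `r`-ball around `u`
and all `s ∈ [0, r]`. -/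
def admissibleRadii (M : Set X) (G : X → ℝ → Prop) (u : X) : Set ℝ :=
  {r | 0 ≤ r ∧ r ≤ 1 ∧ ∀ w ∈ M, dist w u < r → ∀ s ∈ Icc 0 r, G w s}

/-- The largest admissible radius around `u`. -/
def maxRadius (M : Set X) (G : X → ℝ → Prop) (u : X) : ℝ := sSup (admissibleRadii M G u)

variable {M : Set X} {G : X → ℝ → Prop}

theorem zero_mem_admissibleRadii (u : X) : (0 : ℝ) ∈ admissibleRadii M G u :=
  ⟨le_rfl, zero_le_one, fun _ _ h => absurd h (not_lt.2 dist_nonneg)⟩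

theorem bddAbove_admissibleRadii (u : X) : BddAbove (admissibleRadii M G u) :=
  ⟨1, fun _ h => h.2.1⟩

theorem maxRadius_nonneg (u : X) : 0 ≤ maxRadius M G u :=
  le_csSup (bddAbove_admissibleRadii u) (zero_mem_admissibleRadii u)

/-- The ball of radius `r - dist u v` around `v` lies in the ball of radius `r` around `u`. So the
maximal radius is 1-Lipschitz however irregular `G` is, and it can serve as a continuous step
length. -/
theorem maxRadius_le_add (u v : X) : maxRadius M G u ≤ maxRadius M G v + dist u v := by
  refine csSup_le ⟨0, zero_mem_admissibleRadii u⟩ fun r hr => ?_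
  rcases le_or_gt r (dist u v) with h | h
  · linarith [maxRadius_nonneg (M := M) (G := G) v]
  · have : r - dist u v ∈ admissibleRadii M G v := by
      refine ⟨by linarith, by linarith [hr.2.1, dist_nonneg (x := u) (y := v)],
        fun w hw hd s hs => hr.2.2 w hw ?_ s
          ⟨hs.1, by linarith [hs.2, dist_nonneg (x := u) (y := v)]⟩⟩
      linarith [dist_triangle_right w u v, dist_triangle w v u, dist_comm u v]
    linarith [le_csSup (bddAbove_admissibleRadii v) this, show sSup (admissibleRadii M G v) =
      maxRadius M G v from rfl]

theorem continuous_maxRadius : Continuous (maxRadius M G) := by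
  refine (LipschitzWith.of_le_add fun u v => ?_).continuous
  exact maxRadius_le_add u v

theorem maxRadius_spec {u : X} (hu : u ∈ M) {s : ℝ} (hs0 : 0 ≤ s) (hs : s < maxRadius M G u) :
    G u s := by
  obtain ⟨r, hr, hsr⟩ := exists_lt_of_lt_csSup ⟨0, zero_mem_admissibleRadii u⟩ hs
  exact hr.2.2 u hu (by rw [dist_self]; linarith) s ⟨hs0, hsr.le⟩

theorem maxRadius_pos {u : X}
    (h : ∃ δ > 0, ∀ w ∈ M, dist w u < δ → ∀ s ∈ Icc (0 : ℝ) δ, G w s) : 0 < maxRadius M G u := by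
  obtain ⟨δ, hδ, h⟩ := h
  refine (lt_min hδ one_pos).trans_le (le_csSup (bddAbove_admissibleRadii u) ?_)
  exact ⟨(lt_min hδ one_pos).le, min_le_right _ _, fun w hw hd s hs =>
    h w hw (hd.trans_le (min_le_left _ _)) s ⟨hs.1, hs.2.trans (min_le_left _ _)⟩⟩

theorem maxRadius_neg (hM : ∀ u ∈ M, -u ∈ M) (hG : ∀ u ∈ M, ∀ s, G u s → G (-u) s) (u : X) :
    maxRadius M G (-u) = maxRadius M G u := by
  have key : ∀ v : X, admissibleRadii M G v ⊆ admissibleRadii M G (-v) := by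
    intro v r hr
    refine ⟨hr.1, hr.2.1, fun w hw hd s hs => ?_⟩
    have h1 := hr.2.2 (-w) (hM w hw) (by rwa [← dist_neg_neg, neg_neg]) s hs
    simpa using hG _ (hM w hw) s h1
  have h : admissibleRadii M G (-u) = admissibleRadii M G u :=
    Subset.antisymm (by simpa using key (-u)) (key u)
  rw [maxRadius, maxRadius, h]

/-- The data at `w` of a step of length `s` along `S` that descends with slope `σ` without crossing
the level `a`. -/
structure IsDescentStep (M : Set X) (I : X → ℝ) (B : Set X) (a σ : ℝ) (S : ℝ → X → X)
    (w : X) (s : ℝ) : Prop where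
  base_mem : w ∈ B
  mem : S s w ∈ M
  dist_le : dist (S s w) w ≤ s
  descent : I (S s w) ≤ I w - σ * s
  -- Bounds `I` below along the iteration, which makes the total length of the steps finite.
  floor : a ≤ I (S s w)
  cont : ContinuousWithinAt (Function.uncurry S) (univ ×ˢ M) (s, w)

/-- Deformation without a flow: if around each point of `B` short steps along `S` descend with slope
`σ`, then iterating such steps gives an odd map that pushes below the level `a` every point whose
descent cannot leave `B` before it reaches `a`. -/
theorem exists_odd_deformation {M : Set X} (hM : IsComplete M) (hMneg : ∀ u ∈ M, -u ∈ M)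
    {I : X → ℝ} (hI : ContinuousOn I M) (hIneg : ∀ u ∈ M, I (-u) = I u) {B : Set X}
    {a σ : ℝ} (hσ : 0 < σ) {S : ℝ → X → X} (hS0 : ∀ u ∈ M, S 0 u = u)
    (hSneg : ∀ s, ∀ u ∈ M, S s (-u) = -S s u) (hBneg : ∀ u ∈ B, -u ∈ B)
    (hloc : ∀ u ∈ M, u ∈ B → ∃ δ > 0, ∀ w ∈ M, dist w u < δ → ∀ s ∈ Icc (0 : ℝ) δ,
      IsDescentStep M I B a σ S w s) :
    ∃ η : X → X, (∀ u ∈ M, η u ∈ M ∧ η (-u) = -η u) ∧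
      ∀ A ⊆ M, (∀ u ∈ A, ∀ w ∈ M, dist w u ≤ (I u - a) / σ → a < I w → I w ≤ I u → w ∈ B) →
        ContinuousOn η A ∧ ∀ u ∈ A, I (η u) ≤ a := by
  classical
  set G := IsDescentStep M I B a σ S with hG
  set τ := maxRadius M G with hτ
  have hτ0 : ∀ u, 0 ≤ τ u := maxRadius_nonneg
  have hτc : Continuous τ := continuous_maxRadius
  -- Half the maximal radius lies strictly below the supremum, so this step length is admissible
  -- wherever `τ` is positive; where `τ` vanishes, `T` fixes the point.
  set T : X → X := fun u => S (τ u / 2) u with hT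
  have hGneg : ∀ u ∈ M, ∀ s, G u s → G (-u) s := by
    intro u hu s h
    have e := hSneg s u hu
    refine ⟨hBneg u h.base_mem, ?_, ?_, ?_, ?_, ?_⟩
    · rw [e]; exact hMneg _ h.mem
    · rw [e, dist_neg_neg]; exact h.dist_le
    · rw [e, hIneg _ h.mem, hIneg u hu]; exact h.descent
    · rw [e, hIneg _ h.mem]; exact h.floor
    · have h1 : ContinuousWithinAt (fun p : ℝ × X => -S p.1 (-p.2)) (univ ×ˢ M) (s, -u) := by
        have h2 : ContinuousWithinAt (fun p : ℝ × X => (p.1, -p.2)) (univ ×ˢ M) (s, -u) := by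
          fun_prop
        have h3 : ContinuousWithinAt (Function.uncurry S) (univ ×ˢ M)
          ((fun p : ℝ × X => (p.1, -p.2)) (s, -u)) := by simpa using h.cont
        exact (ContinuousWithinAt.comp (f := fun p : ℝ × X => (p.1, -p.2)) h3 h2
          fun p hp => ⟨mem_univ _, hMneg _ hp.2⟩).neg
      refine h1.congr (fun p hp => ?_) ?_
      · simp [Function.uncurry, hSneg _ _ hp.2]
      · simp [Function.uncurry, hSneg _ _ hu]
  have hstep : ∀ u ∈ M, 0 < τ u → G u (τ u / 2) := fun u hu h =>
    maxRadius_spec hu (by linarith) (by change τ u / 2 < τ u; linarith)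
  have hT0 : ∀ u ∈ M, τ u = 0 → T u = u := fun u hu h => by simp [hT, h, hS0 u hu]
  have hcases : ∀ u, τ u = 0 ∨ 0 < τ u := fun u => (hτ0 u).eq_or_lt.imp Eq.symm id
  have hTM : ∀ u ∈ M, T u ∈ M := fun u hu => by
    rcases hcases u with h | h
    · rwa [hT0 u hu h]
    · exact (hstep u hu h).mem
  have hTd : ∀ u ∈ M, dist (T u) u ≤ τ u / 2 := fun u hu => by
    rcases hcases u with h | h
    · rw [hT0 u hu h, dist_self, h, zero_div]
    · exact (hstep u hu h).dist_le
  have hTI : ∀ u ∈ M, I (T u) ≤ I u - σ * (τ u / 2) := fun u hu => by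
    rcases hcases u with h | h
    · rw [hT0 u hu h, h]; simp
    · exact (hstep u hu h).descent
  have hTa : ∀ u ∈ M, min (I u) a ≤ I (T u) := fun u hu => by
    rcases hcases u with h | h
    · rw [hT0 u hu h]; exact min_le_left _ _
    · exact (min_le_right _ _).trans (hstep u hu h).floor
  have hTneg : ∀ u ∈ M, T (-u) = -T u := fun u hu => by
    simp only [hT]
    rw [show τ (-u) = τ u from maxRadius_neg hMneg hGneg u, hSneg _ _ hu]
  have hTc : ContinuousOn T M := by
    intro u hu
    rcases hcases u with h | h
    -- No continuity of `S` is known at a zero of `τ`; the steps nearby are short because `τ` is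
    -- continuous.
    · have h1 : Tendsto (fun w => τ w / 2 + dist w u) (𝓝[M] u) (𝓝 0) := by
        have : Continuous fun w => τ w / 2 + dist w u := by fun_prop
        have h2 := (this.tendsto u).mono_left (nhdsWithin_le_nhds (s := M))
        simpa [h] using h2
      rw [ContinuousWithinAt, hT0 u hu h, tendsto_iff_dist_tendsto_zero]
      refine squeeze_zero' (Eventually.of_forall fun _ => dist_nonneg) ?_ h1
      filter_upwards [self_mem_nhdsWithin] with w hw
      linarith [dist_triangle (T w) w u, hTd w hw]
    · have h1 : ContinuousWithinAt (fun w => (τ w / 2, w)) M u := by fun_prop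
      exact (hstep u hu h).cont.comp (f := fun w => (τ w / 2, w)) h1 fun w hw => ⟨mem_univ _, hw⟩
  have hitM : ∀ n, ∀ u ∈ M, T^[n] u ∈ M := fun n => by
    induction n with
    | zero => exact fun u hu => hu
    | succ n ih => intro u hu; rw [Function.iterate_succ_apply']; exact hTM _ (ih u hu)
  have hitneg : ∀ n, ∀ u ∈ M, T^[n] (-u) = -T^[n] u := fun n => by
    induction n with
    | zero => exact fun u hu => rfl
    | succ n ih =>
      intro u hu
      rw [Function.iterate_succ_apply', Function.iterate_succ_apply', ih u hu,
        hTneg _ (hitM n u hu)]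
  have hitc : ∀ n, ContinuousOn T^[n] M := fun n => by
    induction n with
    | zero => exact continuousOn_id
    | succ n ih => rw [Function.iterate_succ']; exact hTc.comp ih (hitM n)
  have hIanti : ∀ u ∈ M, Antitone fun n => I (T^[n] u) := fun u hu =>
    antitone_nat_of_succ_le fun n => by
      rw [Function.iterate_succ_apply']
      have := hTI _ (hitM n u hu)
      have := mul_nonneg hσ.le (hτ0 (T^[n] u))
      linarith
  have hIlow : ∀ u ∈ M, ∀ n, min (I u) a ≤ I (T^[n] u) := fun u hu n => by
    induction n with
    | zero => exact min_le_left _ _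
    | succ n ih =>
      rw [Function.iterate_succ_apply']
      exact (le_min ih (min_le_right _ _)).trans (hTa _ (hitM n u hu))
  -- Each step costs at least `σ` times its length in energy, so displacements telescope against the
  -- decrease of `I`. This gives convergence and, later, confinement near the starting point.
  have hdist : ∀ u ∈ M, ∀ n, dist (T^[n] u) u ≤ (I u - I (T^[n] u)) / σ := fun u hu n => by
    induction n with
    | zero => simp
    | succ n ih =>
      rw [Function.iterate_succ_apply']
      have h1 := hTI _ (hitM n u hu)
      have h2 := hTd _ (hitM n u hu)
      have h3 := dist_triangle (T (T^[n] u)) (T^[n] u) u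
      rw [le_div_iff₀ hσ] at ih ⊢
      nlinarith
  have hlim : ∀ u ∈ M, ∃ v ∈ M, Tendsto (fun n => T^[n] u) atTop (𝓝 v) := by
    intro u hu
    have hconv := tendsto_atTop_ciInf (hIanti u hu)
      ⟨min (I u) a, by rintro _ ⟨n, rfl⟩; exact hIlow u hu n⟩
    set L := ⨅ n, I (T^[n] u) with hL
    have hLle : ∀ n, L ≤ I (T^[n] u) := (hIanti u hu).le_of_tendsto hconv
    have hcau : CauchySeq fun n => T^[n] u := by
      refine cauchySeq_of_le_tendsto_0' (fun n => (I (T^[n] u) - L) / σ) (fun n m hnm => ?_) ?_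
      · obtain ⟨k, rfl⟩ := Nat.exists_eq_add_of_le hnm
        have h1 := hdist _ (hitM n u hu) k
        rw [← Function.iterate_add_apply, add_comm k n] at h1
        rw [dist_comm]
        refine h1.trans ?_
        have := hLle (n + k)
        gcongr
      · have := (hconv.sub_const L).div_const σ
        simpa using this
    exact cauchySeq_tendsto_of_isComplete hM (fun n => hitM n u hu) hcau
  choose! η hηM hη using hlim
  have hηI : ∀ u ∈ M, Tendsto (fun n => I (T^[n] u)) atTop (𝓝 (I (η u))) := fun u hu =>
    (hI (η u) (hηM u hu)).tendsto.comp (tendsto_nhdsWithin_iff.2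
      ⟨hη u hu, Eventually.of_forall fun n => hitM n u hu⟩)
  have hηle : ∀ u ∈ M, ∀ n, I (η u) ≤ I (T^[n] u) := fun u hu =>
    (hIanti u hu).le_of_tendsto (hηI u hu)
  have hηlow : ∀ u ∈ M, min (I u) a ≤ I (η u) := fun u hu =>
    ge_of_tendsto' (hηI u hu) (hIlow u hu)
  have hηdist : ∀ u ∈ M, dist (η u) u ≤ (I u - I (η u)) / σ := fun u hu =>
    le_of_tendsto_of_tendsto' ((hη u hu).dist tendsto_const_nhds)
      (((hηI u hu).const_sub _).div_const _) (hdist u hu)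
  -- The energy drops tend to zero and dominate `σ * τ / 2`. Hence the limit is a point where no
  -- step is possible, and so lies outside `B`.
  have hητ : ∀ u ∈ M, τ (η u) = 0 := fun u hu => by
    have h1 : Tendsto (fun n => τ (T^[n] u)) atTop (𝓝 (τ (η u))) := (hτc.tendsto _).comp (hη u hu)
    have h2 : Tendsto (fun n => 2 * (I (T^[n] u) - I (T^[n + 1] u)) / σ) atTop (𝓝 0) := by
      have h3 := (((hηI u hu).sub ((tendsto_add_atTop_iff_nat 1).2 (hηI u hu))).const_mul
        2).div_const σ
      simpa using h3
    refine tendsto_nhds_unique h1 (squeeze_zero (fun n => hτ0 _) (fun n => ?_) h2)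
    have := hTI _ (hitM n u hu)
    rw [Function.iterate_succ_apply', le_div_iff₀ hσ]
    linarith
  have hηit : ∀ u ∈ M, ∀ n, η (T^[n] u) = η u := fun u hu n => by
    refine tendsto_nhds_unique (hη _ (hitM n u hu)) ?_
    simp only [← Function.iterate_add_apply]
    exact (tendsto_add_atTop_iff_nat n).2 (hη u hu)
  -- A point that starts below `a` does not move in the limit; any other moves at most its excess
  -- over `a` divided by `σ`.
  have htail : ∀ u ∈ M, dist (η u) u ≤ max 0 (I u - a) / σ := fun u hu => by
    refine (hηdist u hu).trans ?_
    have := hηlow u hu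
    gcongr
    rcases min_cases (I u) a with ⟨h, -⟩ | ⟨h, -⟩ <;> rw [h] at this
    · exact le_max_of_le_left (by linarith)
    · exact le_max_of_le_right (by linarith)
  refine ⟨η, fun u hu => ⟨hηM u hu, ?_⟩, fun A hAM hA => ?_⟩
  · refine tendsto_nhds_unique (hη _ (hMneg u hu)) ?_
    simp only [hitneg _ u hu]
    exact (hη u hu).neg
  have hηa : ∀ u ∈ A, I (η u) ≤ a := by
    intro u huA
    have hu := hAM huA
    by_contra! hlt
    have hle : I (η u) ≤ I u := hηle u hu 0
    have hB := hA u huA (η u) (hηM u hu) ((hηdist u hu).trans (by gcongr)) hlt hle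
    exact (maxRadius_pos (hloc _ (hηM u hu) hB)).ne' (hητ u hu)
  refine ⟨fun u huA => ?_, hηa⟩
  have hu := hAM huA
  rw [ContinuousWithinAt, Metric.tendsto_nhds]
  intro e he
  have he' : 0 < e * σ / 4 := by positivity
  -- After `n` iterations the excess over `a` is small at `u`, hence also at nearby `w`. Both tails
  -- are then at most `e / 4`, and the continuity of `T^[n]` supplies the remaining `e / 4`.
  obtain ⟨n, hn⟩ := ((hηI u hu).eventually_lt_const
    (show I (η u) < a + e * σ / 4 by linarith [hηa u huA])).exists
  have hcn : ContinuousWithinAt T^[n] A u := (hitc n u hu).mono hAM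
  have hcI : ContinuousWithinAt (fun w => I (T^[n] w)) A u :=
    ((hI.comp (hitc n) (hitM n)) u hu).mono hAM
  have hsmall : ∀ w ∈ M, I (T^[n] w) < a + e * σ / 4 → dist (η w) (T^[n] w) ≤ e / 4 := by
    intro w hw h
    have h1 := htail _ (hitM n w hw)
    rw [hηit w hw] at h1
    refine h1.trans ?_
    rw [div_le_iff₀ hσ]
    exact max_le (by positivity) (by linarith)
  filter_upwards [self_mem_nhdsWithin, hcI.eventually_lt_const hn,
    Metric.tendsto_nhds.1 hcn (e / 4) (by positivity)] with w hw h1 h2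
  have h3 := hsmall w (hAM hw) h1
  have h4 := hsmall u hu hn
  have h5 := dist_triangle4 (η w) (T^[n] w) (T^[n] u) (η u)
  rw [dist_comm (T^[n] u)] at h5
  linarith

end Deformation

/-! ### Krasnoselskii genus: monotonicity, subadditivity, compact and finite sets. -/

section Genus

variable {X : Type*} [NormedAddCommGroup X]

theorem genus_le_of_map {V : Type*} [NormedAddCommGroup V] [NormedSpace ℝ V]
    [FiniteDimensional ℝ V] {E : Set X} {ψ : X → V} (hc : ContinuousOn ψ E)
    (hψ : ∀ x ∈ E, ψ (-x) = -ψ x ∧ ψ x ≠ 0) : genus E ≤ (Module.finrank ℝ V : ℕ∞) := by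
  refine iInf₂_le (Module.finrank ℝ V) ⟨fun x => toEuclidean (ψ x),
    toEuclidean.continuous.comp_continuousOn hc, fun x hx => ⟨?_, ?_⟩⟩
  · simp only [(hψ x hx).1, map_neg]
  · simpa using (hψ x hx).2

theorem exists_map_of_genus_le {E : Set X} {n : ℕ} (h : genus E ≤ n) :
    ∃ m ≤ n, ∃ ψ : X → EuclideanSpace ℝ (Fin m),
      ContinuousOn ψ E ∧ ∀ x ∈ E, ψ (-x) = -ψ x ∧ ψ x ≠ 0 := by
  by_contra! hcon
  have h1 : ((n + 1 : ℕ) : ℕ∞) ≤ genus E := by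
    refine le_iInf₂ fun m hm => ?_
    obtain ⟨ψ, hψ, hψ'⟩ := hm
    by_contra! hlt
    have : m ≤ n := by
      have := Nat.cast_lt.1 hlt
      omega
    obtain ⟨x, hx, h2⟩ := hcon m this ψ hψ
    exact (hψ' x hx).2 (h2 (hψ' x hx).1)
  have := Nat.cast_le.1 (h1.trans h)
  omega

theorem genus_le_of_odd_map {A B : Set X} {η : X → X} (hc : ContinuousOn η A)
    (hη : ∀ x ∈ A, η x ∈ B ∧ η (-x) = -η x) : genus A ≤ genus B := by
  refine le_iInf₂ fun n hn => ?_
  obtain ⟨ψ, hψ, hψ'⟩ := hn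
  have h := genus_le_of_map (hψ.comp hc fun x hx => (hη x hx).1) (fun x hx => ⟨by
    simp only [Function.comp, (hη x hx).2, (hψ' _ (hη x hx).1).1], (hψ' _ (hη x hx).1).2⟩)
  simpa using h

theorem genus_mono {A B : Set X} (h : A ⊆ B) : genus A ≤ genus B :=
  genus_le_of_odd_map continuousOn_id fun _ hx => ⟨h hx, rfl⟩

theorem genus_empty : genus (∅ : Set X) = 0 := by
  have h := genus_le_of_map (X := X) (V := EuclideanSpace ℝ (Fin 0)) (E := ∅) (ψ := fun _ => 0)
    (continuousOn_empty _) (by simp)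
  simpa using h

/-- A map that certifies `genus E ≤ n` for a closed set `E` extends to a continuous odd map on the
whole space. -/
theorem exists_global_map_of_genus_le {E : Set X} (hE : IsClosed E) (hneg : ∀ x ∈ E, -x ∈ E)
    {n : ℕ} (h : genus E ≤ n) :
    ∃ m ≤ n, ∃ ψ : X → (Fin m → ℝ), Continuous ψ ∧ (∀ x, ψ (-x) = -ψ x) ∧ ∀ x ∈ E, ψ x ≠ 0 := by
  obtain ⟨m, hm, ψ, hψ, hψ'⟩ := exists_map_of_genus_le h
  let e := EuclideanSpace.equiv (Fin m) ℝ
  have hc : Continuous fun x : E => e (ψ x) :=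
    e.continuous.comp (continuousOn_iff_continuous_domRestrict.1 hψ)
  obtain ⟨g, hg⟩ := ContinuousMap.exists_extension' hE.isClosedEmbedding_subtypeVal
    (⟨_, hc⟩ : C(E, Fin m → ℝ))
  have hgE : ∀ x ∈ E, g x = e (ψ x) := fun x hx => congrFun hg ⟨x, hx⟩
  -- The odd part of a Tietze extension is odd everywhere and still agrees with the given map on the
  -- symmetric set `E`.
  refine ⟨m, hm, fun x => (1 / 2 : ℝ) • (g x - g (-x)), by fun_prop, fun x => ?_, fun x hx => ?_⟩
  · simp only [neg_neg, ← smul_neg, neg_sub]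
  · simp only [hgE x hx, hgE _ (hneg x hx), (hψ' x hx).1, map_neg, sub_neg_eq_add]
    rw [← two_smul ℝ, smul_smul]
    simpa using (hψ' x hx).2

/-- Globally defined odd maps for `A` and `B` can be paired; on the union at least one component is
nonzero. -/
theorem genus_union_le {A B : Set X} (hA : IsClosed A) (hB : IsClosed B)
    (hAneg : ∀ x ∈ A, -x ∈ A) (hBneg : ∀ x ∈ B, -x ∈ B) {a b : ℕ} (ha : genus A ≤ a)
    (hb : genus B ≤ b) : genus (A ∪ B) ≤ (a + b : ℕ) := by
  obtain ⟨m, hm, φ, hφ, hφneg, hφ0⟩ := exists_global_map_of_genus_le hA hAneg ha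
  obtain ⟨n, hn, ψ, hψ, hψneg, hψ0⟩ := exists_global_map_of_genus_le hB hBneg hb
  have h := genus_le_of_map (E := A ∪ B) (ψ := fun x => (φ x, ψ x)) (hφ.prodMk hψ).continuousOn
    (fun x hx => ⟨by rw [hφneg, hψneg, Prod.neg_mk], fun h0 => by
      rw [Prod.mk_eq_zero] at h0
      exact hx.elim (fun hx => hφ0 x hx h0.1) (fun hx => hψ0 x hx h0.2)⟩)
  refine h.trans ?_
  simp only [Module.finrank_prod, Module.finrank_fintype_fun_eq_card, Fintype.card_fin]
  exact_mod_cast add_le_add hm hn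

/-- A closed thickening of a compact symmetric set has no larger genus. -/
theorem exists_genus_cthickening_le {K : Set X} (hK : IsCompact K) (hneg : ∀ x ∈ K, -x ∈ K)
    {n : ℕ} (h : genus K ≤ n) : ∃ ρ > 0, genus (Metric.cthickening ρ K) ≤ n := by
  obtain ⟨m, hm, ψ, hψ, hψneg, hψ0⟩ := exists_global_map_of_genus_le hK.isClosed hneg h
  have ho : IsOpen {x | ψ x ≠ 0} := isOpen_ne_fun hψ continuous_const
  obtain ⟨ρ, hρ, hsub⟩ := hK.exists_cthickening_subset_open ho fun x hx => hψ0 x hx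
  refine ⟨ρ, hρ, ?_⟩
  have h := genus_le_of_map (E := Metric.cthickening ρ K) hψ.continuousOn
    fun x hx => ⟨hψneg x, hsub hx⟩
  refine h.trans ?_
  simpa using hm

/-- Linear functionals are odd, and by Hahn-Banach the sets where one of them is nonzero cover `K`.
A finite subcover gives a map into a finite product of lines. -/
theorem exists_genus_le_of_isCompact [NormedSpace ℝ X] {K : Set X} (hK : IsCompact K)
    (h0 : (0 : X) ∉ K) :
    ∃ n : ℕ, genus K ≤ n := by
  have hex : ∀ x : X, x ∈ K → ∃ l : StrongDual ℝ X, l x ≠ 0 := fun x hx => by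
    have hx0 : x ≠ 0 := fun h => h0 (h ▸ hx)
    obtain ⟨l, -, hl⟩ := exists_dual_vector ℝ x (norm_ne_zero_iff.2 hx0)
    exact ⟨l, by rw [hl]; simpa using hx0⟩
  obtain ⟨t, ht⟩ := hK.elim_finite_subcover (fun l : StrongDual ℝ X => {x | l x ≠ 0})
    (fun l => isOpen_ne_fun l.continuous continuous_const)
    fun x hx => mem_iUnion.2 (hex x hx)
  refine ⟨_, genus_le_of_map (V := t → ℝ) (ψ := fun x l => (l : StrongDual ℝ X) x)
    (by fun_prop) fun x hx => ⟨by ext l; simp, fun h => ?_⟩⟩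
  obtain ⟨l, hl, hlx⟩ := mem_iUnion₂.1 (ht hx)
  exact hlx (congrFun h ⟨l, hl⟩)

theorem genus_le_one_of_finite [NormedSpace ℝ X] {K : Set X} (hK : K.Finite)
    (h0 : (0 : X) ∉ K) : genus K ≤ 1 := by
  have : Finite K := hK
  obtain ⟨l, hl⟩ := Module.exists_dual_forall_apply_ne_zero (K := ℝ) (fun x : K => (x : X))
    fun x h => h0 (h ▸ x.2)
  have h := genus_le_of_map (E := K) (V := ℝ) (ψ := fun x => l x) (hK.continuousOn _)
    fun x hx => ⟨by simp, hl ⟨x, hx⟩⟩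
  simpa using h

end Genus

/-! ### Radial hypersurfaces: C¹ retraction, differentials and the Palais-Smale condition. -/

section Hypersurface

variable {X : Type*} [NormedAddCommGroup X] [NormedSpace ℝ X]

/-- `J` is an even `C¹` function that increases strictly along all rays, and `lam` is not its value
at the origin. The level set `{J = lam}` is then a `C¹` hypersurface transversal to the rays. -/
structure IsRadialConstraint (J : X → ℝ) (lam : ℝ) : Prop where
  contDiff : ContDiff ℝ 1 J
  even : ∀ x, J (-x) = J x
  zero_ne : J 0 ≠ lam
  pos : ∀ x, x ≠ 0 → 0 < fderiv ℝ J x x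

/-- The factor that scales `x` to the level set `{J = lam}`, if there is one. -/
def radialScale (J : X → ℝ) (lam : ℝ) (x : X) : ℝ :=
  Classical.epsilon fun t : ℝ => 0 < t ∧ J (t • x) = lam

/-- The radial retraction of a neighbourhood of the level set `{J = lam}` onto this set. -/
def radialRetraction (J : X → ℝ) (lam : ℝ) (x : X) : X := radialScale J lam x • x

namespace IsRadialConstraint

variable {J : X → ℝ} {lam : ℝ}

theorem hasFDerivAt (h : IsRadialConstraint J lam) (x : X) : HasFDerivAt J (fderiv ℝ J x) x :=
  (h.contDiff.differentiable one_ne_zero x).hasFDerivAt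

theorem ne_zero (h : IsRadialConstraint J lam) {u : X} (hu : J u = lam) : u ≠ 0 := by
  rintro rfl
  exact h.zero_ne hu

theorem strictMonoOn_ray (h : IsRadialConstraint J lam) {x : X} (hx : x ≠ 0) :
    StrictMonoOn (fun t : ℝ => J (t • x)) (Ioi 0) := by
  have hd : ∀ t : ℝ, HasDerivAt (fun t : ℝ => J (t • x)) (fderiv ℝ J (t • x) x) t := fun t => by
    have h1 : HasDerivAt (fun t : ℝ => t • x) x t := by
      simpa using (hasDerivAt_id t).smul_const x
    exact (h.hasFDerivAt (t • x)).comp_hasDerivAt t h1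
  refine strictMonoOn_of_deriv_pos (convex_Ioi 0)
    (fun t _ => (hd t).continuousAt.continuousWithinAt) fun t ht => ?_
  rw [interior_Ioi, mem_Ioi] at ht
  rw [(hd t).deriv]
  have h1 := h.pos (t • x) (smul_ne_zero ht.ne' hx)
  rw [map_smul, smul_eq_mul] at h1
  exact pos_of_mul_pos_right h1 ht.le

theorem radialScale_eq (h : IsRadialConstraint J lam) {x : X} (hx : x ≠ 0) {t : ℝ} (ht : 0 < t)
    (htx : J (t • x) = lam) : radialScale J lam x = t := by
  have hsp := Classical.epsilon_spec (p := fun t : ℝ => 0 < t ∧ J (t • x) = lam) ⟨t, ht, htx⟩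
  exact (h.strictMonoOn_ray hx).injOn hsp.1 ht (hsp.2.trans htx.symm)

theorem radialRetraction_neg (h : IsRadialConstraint J lam) (x : X) :
    radialRetraction J lam (-x) = -radialRetraction J lam x := by
  have : radialScale J lam (-x) = radialScale J lam x := by
    simp only [radialScale, smul_neg, h.even]
  rw [radialRetraction, radialRetraction, this, smul_neg]

theorem radialScale_eq_one (h : IsRadialConstraint J lam) {u : X} (hu : J u = lam) :
    radialScale J lam u = 1 :=
  h.radialScale_eq (h.ne_zero hu) one_pos (by rwa [one_smul])

theorem radialRetraction_eq_self (h : IsRadialConstraint J lam) {u : X} (hu : J u = lam) :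
    radialRetraction J lam u = u := by
  rw [radialRetraction, h.radialScale_eq_one hu, one_smul]

variable [CompleteSpace X]

/-- The implicit function theorem applies to `(x, t) ↦ J (t • x)` at `(u, 1)`, whose `t`-derivative
`fderiv ℝ J u u` is positive. Monotonicity along rays identifies the local solution with
`radialScale`. -/
theorem contDiffAt_radialScale (h : IsRadialConstraint J lam) {u : X} (hu : J u = lam) :
    ContDiffAt ℝ 1 (radialScale J lam) u ∧ ∀ᶠ x in 𝓝 u, J (radialRetraction J lam x) = lam := by
  set f : X × ℝ → ℝ := fun p => J (p.2 • p.1) with hf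
  have hfc : ContDiffAt ℝ 1 f (u, 1) :=
    (h.contDiff.comp (contDiff_snd.smul contDiff_fst)).contDiffAt
  have hpos := h.pos u (h.ne_zero hu)
  have hcomp : fderiv ℝ f (u, (1 : ℝ)) ∘L .inr ℝ X ℝ =
      (ContinuousLinearEquiv.unitsEquivAut ℝ (Units.mk0 _ hpos.ne') : ℝ →L[ℝ] ℝ) := by
    have h1 : HasFDerivAt (fun t : ℝ => f (u, t)) (fderiv ℝ f (u, (1 : ℝ)) ∘L .inr ℝ X ℝ) 1 :=
      HasFDerivAt.comp (1 : ℝ) (hfc.differentiableAt one_ne_zero).hasFDerivAt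
        (hasFDerivAt_prodMk_right u (1 : ℝ))
    have h2 : HasDerivAt (fun t : ℝ => f (u, t)) (fderiv ℝ J u u) 1 := by
      have h3 : HasDerivAt (fun t : ℝ => t • u) u 1 := by
        simpa using (hasDerivAt_id (1 : ℝ)).smul_const u
      have h4 := h.hasFDerivAt ((1 : ℝ) • u)
      have := h4.comp_hasDerivAt (1 : ℝ) h3
      rwa [one_smul] at this
    rw [h1.unique h2.hasFDerivAt]
    ext
    simp
  have hinv : (fderiv ℝ f (u, (1 : ℝ)) ∘L .inr ℝ X ℝ).IsInvertible := ⟨_, hcomp.symm⟩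
  set ψ := hfc.implicitFunction one_ne_zero hinv with hψ
  have hψc : ContDiffAt ℝ 1 ψ u := hfc.contDiffAt_implicitFunction one_ne_zero hinv
  have hψ1 : ψ u = 1 := hfc.implicitFunction_apply_self one_ne_zero hinv
  have hev : ∀ᶠ x in 𝓝 u, J (ψ x • x) = lam := by
    have := hfc.eventually_apply_implicitFunction one_ne_zero hinv
    filter_upwards [this] with x hx
    simpa [hf, hu] using hx
  have hpos' : ∀ᶠ x in 𝓝 u, 0 < ψ x :=
    hψc.continuousAt.eventually_const_lt (by rw [hψ1]; exact one_pos)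
  have hne : ∀ᶠ x in 𝓝 u, x ≠ 0 := eventually_ne_nhds (h.ne_zero hu)
  have heq : radialScale J lam =ᶠ[𝓝 u] ψ := by
    filter_upwards [hev, hpos', hne] with x h1 h2 h3
    exact h.radialScale_eq h3 h2 h1
  refine ⟨hψc.congr_of_eventuallyEq heq, ?_⟩
  filter_upwards [heq, hev] with x h1 h2
  rwa [radialRetraction, h1]

theorem contDiffAt_radialRetraction (h : IsRadialConstraint J lam) {u : X} (hu : J u = lam) :
    ContDiffAt ℝ 1 (radialRetraction J lam) u :=
  (h.contDiffAt_radialScale hu).1.smul contDiffAt_id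

theorem eventually_radialRetraction_mem (h : IsRadialConstraint J lam) {u : X} (hu : J u = lam) :
    ∀ᶠ x in 𝓝 u, J (radialRetraction J lam x) = lam :=
  (h.contDiffAt_radialScale hu).2

/-- The derivative of `radialRetraction` sends `v` to `v` plus a multiple of `u`. As `J` is constant
on the image, `fderiv ℝ J u` kills that vector, and it does not kill `u`, so the multiple is zero.
-/
theorem fderiv_radialRetraction_apply (h : IsRadialConstraint J lam) {u : X} (hu : J u = lam)
    {v : X} (hv : fderiv ℝ J u v = 0) : fderiv ℝ (radialRetraction J lam) u v = v := by
  have hs := ((h.contDiffAt_radialScale hu).1.differentiableAt one_ne_zero).hasFDerivAt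
  have hr : HasFDerivAt (radialRetraction J lam) _ u := hs.smul (hasFDerivAt_id u)
  rw [h.radialScale_eq_one hu] at hr
  have hval : fderiv ℝ (radialRetraction J lam) u v =
      v + fderiv ℝ (radialScale J lam) u v • u := by
    rw [hr.fderiv]
    simp
  have hJ := h.hasFDerivAt (radialRetraction J lam u)
  have hc := hJ.comp u
    (h.contDiffAt_radialRetraction hu |>.differentiableAt one_ne_zero).hasFDerivAt
  have hconst : J ∘ radialRetraction J lam =ᶠ[𝓝 u] fun _ => lam :=
    h.eventually_radialRetraction_mem hu
  have h0 := hc.unique ((hasFDerivAt_const lam u).congr_of_eventuallyEq hconst)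
  have h1 := congrArg (fun L => L v) h0
  simp only [ContinuousLinearMap.comp_apply, h.radialRetraction_eq_self hu, hval, map_add, hv,
    map_smul, smul_eq_mul, zero_add, zero_apply] at h1
  have h2 := (mul_eq_zero.1 h1).resolve_right (h.pos u (h.ne_zero hu)).ne'
  rw [hval, h2, zero_smul, add_zero]

end IsRadialConstraint

theorem IsCritPt.diffNorm_eq_zero {M : Set X} {u : X}
    (h : IsCritPt M I u) : diffNorm M I u = 0 := by
  simp only [diffNorm, ENNReal.iSup_eq_zero]
  rintro γ ⟨hγ, -⟩
  rw [(h.2 γ hγ).deriv]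
  simp

/-- The extension of a function on `{J = lam}` to a neighbourhood that is constant along rays. -/
def radialExtension (J : X → ℝ) (lam : ℝ) (I : X → ℝ) (x : X) : ℝ := I (radialRetraction J lam x)

namespace IsRadialConstraint

variable {J : X → ℝ} {lam : ℝ} {I : X → ℝ}

theorem isClosed (h : IsRadialConstraint J lam) : IsClosed {x | J x = lam} :=
  isClosed_eq h.contDiff.continuous continuous_const

theorem neg_mem (h : IsRadialConstraint J lam) : ∀ u ∈ {x | J x = lam}, -u ∈ {x | J x = lam} :=
  fun u hu => (h.even u).trans hu

theorem radialExtension_eq (h : IsRadialConstraint J lam) {u : X} (hu : J u = lam) :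
    radialExtension J lam I u = I u := by
  rw [radialExtension, h.radialRetraction_eq_self hu]

theorem isCritPt_neg (h : IsRadialConstraint J lam) (hIneg : ∀ u, J u = lam → I (-u) = I u)
    {u : X} (hu : IsCritPt {x | J x = lam} I u) : IsCritPt {x | J x = lam} I (-u) := by
  refine ⟨h.neg_mem u hu.1, fun γ hγ => ?_⟩
  obtain ⟨hγ0, ε, hε, hγc, hγM⟩ := hγ
  have := hu.2 (fun t => -γ t) ⟨by simp [hγ0], ε, hε, hγc.neg, fun t ht => h.neg_mem _ (hγM t ht)⟩
  refine this.congr_of_eventuallyEq ?_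
  filter_upwards [Ioo_mem_nhds (show -ε < 0 by linarith) hε] with t ht
  exact (hIneg _ (hγM t ht)).symm

variable [CompleteSpace X]

theorem contDiffAt_radialExtension (h : IsRadialConstraint J lam)
    (hI : IsC1On {x | J x = lam} I) {u : X} (hu : J u = lam) :
    ContDiffAt ℝ 1 (radialExtension J lam I) u := by
  obtain ⟨U, hU, huU, F, hF, hFI⟩ := hI u hu
  have hπ := h.contDiffAt_radialRetraction hu
  have hπu := h.radialRetraction_eq_self hu
  have hFu : ContDiffAt ℝ 1 F (radialRetraction J lam u) := by
    rw [hπu]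
    exact hF.contDiffAt (hU.mem_nhds huU)
  refine (hFu.comp u hπ).congr_of_eventuallyEq ?_
  have hUev : ∀ᶠ x in 𝓝 u, radialRetraction J lam x ∈ U :=
    hπ.continuousAt.eventually_mem (by rw [hπu]; exact hU.mem_nhds huU)
  filter_upwards [hUev, h.eventually_radialRetraction_mem hu] with x h1 h2
  exact (hFI ⟨h1, h2⟩).symm

theorem continuousOn (h : IsRadialConstraint J lam) (hI : IsC1On {x | J x = lam} I) :
    ContinuousOn I {x | J x = lam} := fun _ hu =>
  ((h.contDiffAt_radialExtension hI hu).continuousAt.continuousWithinAt).congr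
    (fun _ hw => (h.radialExtension_eq hw).symm) (h.radialExtension_eq hu).symm

theorem hasDerivAt_curve (h : IsRadialConstraint J lam) (hI : IsC1On {x | J x = lam} I)
    {u : X} (hu : J u = lam) {γ : ℝ → X} (hγ : IsCurveThrough {x | J x = lam} u γ) :
    HasDerivAt (fun t => I (γ t)) (fderiv ℝ (radialExtension J lam I) u (deriv γ 0)) 0 ∧
      fderiv ℝ J u (deriv γ 0) = 0 := by
  obtain ⟨hγ0, ε, hε, hγc, hγM⟩ := hγ
  have hmem : Ioo (-ε) ε ∈ 𝓝 (0 : ℝ) := Ioo_mem_nhds (by linarith) hε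
  have hd : HasDerivAt γ (deriv γ 0) 0 :=
    ((hγc.contDiffAt hmem).differentiableAt one_ne_zero).hasDerivAt
  constructor
  · have h1 := ((h.contDiffAt_radialExtension hI hu).differentiableAt one_ne_zero).hasFDerivAt
    rw [← hγ0] at h1
    have h2 := h1.comp_hasDerivAt (0 : ℝ) hd
    rw [hγ0] at h2
    refine h2.congr_of_eventuallyEq ?_
    filter_upwards [hmem] with t ht
    exact (h.radialExtension_eq (hγM t ht)).symm
  · have h1 := h.hasFDerivAt u
    rw [← hγ0] at h1
    have h2 := h1.comp_hasDerivAt (0 : ℝ) hd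
    rw [hγ0] at h2
    refine h2.unique ((hasDerivAt_const (0 : ℝ) lam).congr_of_eventuallyEq ?_)
    filter_upwards [hmem] with t ht
    exact hγM t ht

/-- The retracted line `t ↦ radialRetraction J lam (u + t • v)` is an admissible test curve, and `I`
along it is the radial extension along the line itself. -/
theorem ofReal_fderiv_le_diffNorm (h : IsRadialConstraint J lam)
    (hI : IsC1On {x | J x = lam} I) {u : X} (hu : J u = lam) {v : X}
    (hv : ‖fderiv ℝ (radialRetraction J lam) u v‖ ≤ 1) :
    ENNReal.ofReal |fderiv ℝ (radialExtension J lam I) u v| ≤ diffNorm {x | J x = lam} I u := by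
  set ℓ : ℝ → X := fun t => u + t • v with hℓ
  have hℓ0 : ℓ 0 = u := by simp [hℓ]
  have hℓc : ContDiff ℝ 1 ℓ := by fun_prop
  have hℓd : HasDerivAt ℓ v 0 := by
    have := ((hasDerivAt_id (0 : ℝ)).smul_const v).const_add u
    rwa [one_smul] at this
  set γ : ℝ → X := fun t => radialRetraction J lam (ℓ t) with hγ
  have hπ : ContDiffAt ℝ 1 (radialRetraction J lam) (ℓ 0) := by
    rw [hℓ0]; exact h.contDiffAt_radialRetraction hu
  have hγd : HasDerivAt γ (fderiv ℝ (radialRetraction J lam) u v) 0 := by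
    have := (hπ.differentiableAt one_ne_zero).hasFDerivAt.comp_hasDerivAt (0 : ℝ) hℓd
    rwa [hℓ0] at this
  have hγev : ∀ᶠ t in 𝓝 (0 : ℝ), ContDiffAt ℝ 1 γ t :=
    (hπ.comp (0 : ℝ) hℓc.contDiffAt).eventually (by simp)
  have hγM : ∀ᶠ t in 𝓝 (0 : ℝ), γ t ∈ {x | J x = lam} := by
    have := h.eventually_radialRetraction_mem hu
    rw [← hℓ0] at this
    exact hℓc.continuous.continuousAt.eventually this
  obtain ⟨ε, hε, hball⟩ := Metric.eventually_nhds_iff_ball.1 (hγev.and hγM)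
  have hcurve : IsCurveThrough {x | J x = lam} u γ := by
    refine ⟨by simp only [hγ, hℓ0, h.radialRetraction_eq_self hu], ε, hε, fun t ht => ?_,
      fun t ht => ?_⟩
    · exact (hball t (by simpa [Real.ball_eq_Ioo] using ht)).1.contDiffWithinAt
    · exact (hball t (by simpa [Real.ball_eq_Ioo] using ht)).2
  have hderiv : HasDerivAt (fun t => I (γ t)) (fderiv ℝ (radialExtension J lam I) u v) 0 := by
    have h1 := ((h.contDiffAt_radialExtension hI hu).differentiableAt one_ne_zero).hasFDerivAt
    rw [← hℓ0] at h1
    have h2 := h1.comp_hasDerivAt (0 : ℝ) hℓd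
    rwa [hℓ0] at h2
  have := le_iSup₂ (f := fun (γ : ℝ → X)
    (_ : IsCurveThrough {x | J x = lam} u γ ∧ ‖deriv γ 0‖ ≤ 1) =>
      ENNReal.ofReal |deriv (fun t => I (γ t)) 0|) γ ⟨hcurve, by rwa [hγd.deriv]⟩
  rwa [hderiv.deriv] at this

theorem isCritPt_of_fderiv_eq_zero (h : IsRadialConstraint J lam)
    (hI : IsC1On {x | J x = lam} I) {u : X} (hu : J u = lam)
    (h0 : fderiv ℝ (radialExtension J lam I) u = 0) : IsCritPt {x | J x = lam} I u :=
  ⟨hu, fun γ hγ => by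
    have := (h.hasDerivAt_curve hI hu hγ).1
    rwa [h0, zero_apply] at this⟩

/-- A limit of points of the hypersurface at which the differential tends to zero is critical. -/
theorem isCritPt_of_tendsto (h : IsRadialConstraint J lam) (hI : IsC1On {x | J x = lam} I)
    {v : ℕ → X} {w : X} (hv : ∀ n, J (v n) = lam) (hw : J w = lam)
    (hlim : Tendsto v atTop (𝓝 w))
    (hd : Tendsto (fun n => diffNorm {x | J x = lam} I (v n)) atTop (𝓝 0)) :
    IsCritPt {x | J x = lam} I w := by
  refine h.isCritPt_of_fderiv_eq_zero hI hw ?_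
  ext e
  have h1 : Tendsto (fun n => fderiv ℝ (radialExtension J lam I) (v n)) atTop
      (𝓝 (fderiv ℝ (radialExtension J lam I) w)) :=
    ((h.contDiffAt_radialExtension hI hw).continuousAt_fderiv one_ne_zero).tendsto.comp hlim
  have h2 : Tendsto (fun n => fderiv ℝ (radialRetraction J lam) (v n)) atTop
      (𝓝 (fderiv ℝ (radialRetraction J lam) w)) :=
    ((h.contDiffAt_radialRetraction hw).continuousAt_fderiv one_ne_zero).tendsto.comp hlim
  -- Dividing `e` by `C` makes the test curves through `v n` in the direction `e` have speed at most
  -- one for all large `n`, since the derivative of the retraction is continuous at `w`.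
  set C := ‖fderiv ℝ (radialRetraction J lam) w e‖ + 1 with hC
  have hCpos : 0 < C := by positivity
  have h3 : ∀ᶠ n in atTop, ‖fderiv ℝ (radialRetraction J lam) (v n) e‖ < C :=
    ((((ContinuousLinearMap.apply ℝ _ _).continuous.tendsto _).comp h2).norm).eventually_lt_const
      (lt_add_one _)
  have h4 : Tendsto (fun n => fderiv ℝ (radialExtension J lam I) (v n) (C⁻¹ • e)) atTop
      (𝓝 (fderiv ℝ (radialExtension J lam I) w (C⁻¹ • e))) :=
    ((ContinuousLinearMap.apply ℝ _ _).continuous.tendsto _).comp h1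
  have h5 : Tendsto (fun n => ENNReal.ofReal
      |fderiv ℝ (radialExtension J lam I) (v n) (C⁻¹ • e)|) atTop (𝓝 0) := by
    refine tendsto_of_tendsto_of_tendsto_of_le_of_le' tendsto_const_nhds hd
      (Eventually.of_forall fun _ => zero_le) ?_
    filter_upwards [h3] with n hn
    refine h.ofReal_fderiv_le_diffNorm hI (hv n) ?_
    rw [map_smul, norm_smul, norm_inv, Real.norm_of_nonneg hCpos.le, inv_mul_le_iff₀ hCpos]
    linarith
  have h6 := tendsto_nhds_unique h5 (ENNReal.tendsto_ofReal h4.abs)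
  rw [eq_comm, ENNReal.ofReal_eq_zero] at h6
  have h7 := abs_eq_zero.1 (le_antisymm h6 (abs_nonneg _))
  rw [map_smul, smul_eq_mul] at h7
  exact (mul_eq_zero.1 h7).resolve_left (inv_ne_zero hCpos.ne')

theorem isCompact_critSet (h : IsRadialConstraint J lam) (hI : IsC1On {x | J x = lam} I) {c : ℝ}
    (hPS : PalaisSmale {x | J x = lam} I c) : IsCompact (critSet {x | J x = lam} I c) := by
  rw [isCompact_iff_isSeqCompact]
  intro v hv
  have hd : ∀ n, diffNorm {x | J x = lam} I (v n) = 0 := fun n => (hv n).1.diffNorm_eq_zero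
  obtain ⟨w, hw, s, hs, hlim⟩ := hPS v (fun n => (hv n).1.1)
    (by simp only [(hv _).2]; exact tendsto_const_nhds)
    (by simp only [hd]; exact tendsto_const_nhds)
  refine ⟨w, ⟨h.isCritPt_of_tendsto hI (fun n => (hv (s n)).1.1) hw hlim
    (by simp only [hd]; exact tendsto_const_nhds), ?_⟩, s, hs, hlim⟩
  have h1 : Tendsto (fun n => I (v (s n))) atTop (𝓝 (I w)) :=
    ((h.continuousOn hI) w hw).tendsto.comp (tendsto_nhdsWithin_iff.2
      ⟨hlim, Eventually.of_forall fun n => (hv (s n)).1.1⟩)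
  simp only [(hv _).2] at h1
  exact tendsto_nhds_unique h1 tendsto_const_nhds

/-- Away from the critical points of level `c`, the differential is bounded below near the
level `c`. -/
theorem exists_diffNorm_ge (h : IsRadialConstraint J lam) (hI : IsC1On {x | J x = lam} I) {c : ℝ}
    (hPS : PalaisSmale {x | J x = lam} I c) {ρ : ℝ} (hρ : 0 < ρ) :
    ∃ ε > 0, ∀ u, J u = lam → |I u - c| < ε →
      u ∉ Metric.thickening ρ (critSet {x | J x = lam} I c) →
      ENNReal.ofReal ε ≤ diffNorm {x | J x = lam} I u := by
  by_contra! hcon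
  -- Failure for every `1 / (n + 1)` produces a Palais-Smale sequence outside an open neighbourhood
  -- of the critical set, while its subsequential limit must lie in that set.
  have hcon' : ∀ n : ℕ, ∃ u, J u = lam ∧ |I u - c| < 1 / ((n : ℝ) + 1) ∧
      u ∉ Metric.thickening ρ (critSet {x | J x = lam} I c) ∧
      diffNorm {x | J x = lam} I u < ENNReal.ofReal (1 / ((n : ℝ) + 1)) := fun n =>
    hcon _ Nat.one_div_pos_of_nat
  choose v hvM hvI hvK hvd using hcon'
  have hzero : Tendsto (fun n : ℕ => 1 / ((n : ℝ) + 1)) atTop (𝓝 0) :=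
    tendsto_one_div_add_atTop_nhds_zero_nat
  have hIlim : Tendsto (fun n => I (v n)) atTop (𝓝 c) := by
    rw [tendsto_iff_dist_tendsto_zero]
    exact squeeze_zero (fun _ => dist_nonneg) (fun n => (hvI n).le) hzero
  have hdlim : Tendsto (fun n => diffNorm {x | J x = lam} I (v n)) atTop (𝓝 0) := by
    refine tendsto_of_tendsto_of_tendsto_of_le_of_le tendsto_const_nhds ?_
      (fun _ => zero_le) (fun n => (hvd n).le)
    simpa using ENNReal.tendsto_ofReal hzero
  obtain ⟨w, hw, s, hs, hlim⟩ := hPS v hvM hIlim hdlim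
  have hcrit := h.isCritPt_of_tendsto hI (fun n => hvM (s n)) hw hlim
    (hdlim.comp hs.tendsto_atTop)
  have hIw : I w = c := by
    have h1 : Tendsto (fun n => I (v (s n))) atTop (𝓝 (I w)) :=
      ((h.continuousOn hI) w hw).tendsto.comp (tendsto_nhdsWithin_iff.2
        ⟨hlim, Eventually.of_forall fun n => hvM (s n)⟩)
    exact tendsto_nhds_unique h1 (hIlim.comp hs.tendsto_atTop)
  have hmem : w ∈ Metric.thickening ρ (critSet {x | J x = lam} I c) :=
    Metric.self_subset_thickening hρ _ ⟨hcrit, hIw⟩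
  obtain ⟨n, hn⟩ := (hlim.eventually_mem (Metric.isOpen_thickening.mem_nhds hmem)).exists
  exact hvK _ hn

end IsRadialConstraint

end Hypersurface

/-! ### The tangential gradient and short descent steps. -/

section Descent

variable {X : Type*} [NormedAddCommGroup X] [InnerProductSpace ℝ X]

/-- The component of `g` orthogonal to `n`. -/
def orthPart (n g : X) : X := g - (inner ℝ n g / ‖n‖ ^ 2) • n

theorem inner_orthPart {n g v : X} (hv : inner ℝ n v = 0) :
    inner ℝ (orthPart n g) v = inner ℝ g v := by
  rw [orthPart, inner_sub_left, real_inner_smul_left, hv, mul_zero, sub_zero]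

theorem inner_left_orthPart {n : X} (hn : n ≠ 0) (g : X) : inner ℝ n (orthPart n g) = 0 := by
  have : ‖n‖ ^ 2 ≠ 0 := by simpa using hn
  rw [orthPart, inner_sub_right, real_inner_smul_right, real_inner_self_eq_norm_sq,
    div_mul_cancel₀ _ this, sub_self]

theorem orthPart_neg_neg (n g : X) : orthPart (-n) (-g) = -orthPart n g := by
  simp only [orthPart, inner_neg_neg, norm_neg, smul_neg]
  abel

variable [CompleteSpace X]

/-- The tangential gradient at `u` of the radial extension of `I`. -/
def tangentialGradient (J : X → ℝ) (lam : ℝ) (I : X → ℝ) (u : X) : X :=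
  orthPart (gradient J u) (gradient (radialExtension J lam I) u)

/-- The descent direction: the negative tangential gradient, scaled to the length `1 / 2`. -/
def descentField (J : X → ℝ) (lam : ℝ) (I : X → ℝ) (u : X) : X :=
  -((1 / 2 * ‖tangentialGradient J lam I u‖⁻¹) • tangentialGradient J lam I u)

/-- One step of length `s` in the descent direction, followed by the radial retraction. -/
def descentStep (J : X → ℝ) (lam : ℝ) (I : X → ℝ) (s : ℝ) (u : X) : X :=
  radialRetraction J lam (u + s • descentField J lam I u)

theorem inner_gradient (F : X → ℝ) (u v : X) : inner ℝ (gradient F u) v = fderiv ℝ F u v :=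
  InnerProductSpace.toDual_symm_apply

theorem gradient_neg_of_even {F : X → ℝ} {u : X} (h : ∀ᶠ x in 𝓝 u, F (-x) = F x) :
    gradient F (-u) = -gradient F u := by
  have h1 : fderiv ℝ F u = -fderiv ℝ F (-u) := by
    have h2 := (ContinuousLinearEquiv.neg ℝ : X ≃L[ℝ] X).comp_right_fderiv (f := F) (x := u)
    rw [show F ∘ (ContinuousLinearEquiv.neg ℝ : X ≃L[ℝ] X) = fun x => F (-x) from rfl,
      Filter.EventuallyEq.fderiv_eq h] at h2
    rw [h2]
    ext v
    simp
  rw [gradient, gradient, h1, map_neg, neg_neg]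

theorem norm_descentField_le (J : X → ℝ) (lam : ℝ) (I : X → ℝ) (u : X) :
    ‖descentField J lam I u‖ ≤ 1 / 2 := by
  rw [descentField, norm_neg, norm_smul, norm_mul, norm_inv, norm_norm, mul_assoc]
  rcases eq_or_ne ‖tangentialGradient J lam I u‖ 0 with h | h
  · rw [h]; norm_num
  · rw [inv_mul_cancel₀ h]; norm_num

namespace IsRadialConstraint

variable {J : X → ℝ} {lam : ℝ} {I : X → ℝ}

theorem gradient_ne_zero (h : IsRadialConstraint J lam) {u : X} (hu : J u = lam) :
    gradient J u ≠ 0 := fun h0 => by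
  have := h.pos u (h.ne_zero hu)
  rw [← inner_gradient, h0, inner_zero_left] at this
  exact this.false

theorem continuousAt_gradient {F : X → ℝ} {u : X} (hF : ContDiffAt ℝ 1 F u) :
    ContinuousAt (gradient F) u :=
  (InnerProductSpace.toDual ℝ X).symm.continuous.continuousAt.comp
    (hF.continuousAt_fderiv one_ne_zero)

theorem continuousAt_tangentialGradient (h : IsRadialConstraint J lam)
    (hI : IsC1On {x | J x = lam} I) {u : X} (hu : J u = lam) :
    ContinuousAt (tangentialGradient J lam I) u := by
  have h1 : ContinuousAt (gradient J) u := continuousAt_gradient h.contDiff.contDiffAt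
  have h2 := continuousAt_gradient (h.contDiffAt_radialExtension hI hu)
  have h3 : ‖gradient J u‖ ^ 2 ≠ 0 := by simpa using h.gradient_ne_zero hu
  exact h2.sub (((h1.inner h2).div (h1.norm.pow 2) h3).smul h1)

theorem continuousAt_descentField (h : IsRadialConstraint J lam)
    (hI : IsC1On {x | J x = lam} I) {u : X} (hu : J u = lam)
    (h0 : tangentialGradient J lam I u ≠ 0) : ContinuousAt (descentField J lam I) u := by
  have h1 := h.continuousAt_tangentialGradient hI hu
  exact (((h1.norm.inv₀ (norm_ne_zero_iff.2 h0)).const_mul _).smul h1).neg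

/-- Velocities of curves in the hypersurface are orthogonal to `gradient J u`, so only the
orthogonal part of the gradient of the extension is seen. -/
theorem diffNorm_le_norm_tangentialGradient (h : IsRadialConstraint J lam)
    (hI : IsC1On {x | J x = lam} I) {u : X} (hu : J u = lam) :
    diffNorm {x | J x = lam} I u ≤ ENNReal.ofReal ‖tangentialGradient J lam I u‖ := by
  refine iSup₂_le fun γ hγ => ENNReal.ofReal_le_ofReal ?_
  obtain ⟨h1, h2⟩ := h.hasDerivAt_curve hI hu hγ.1
  rw [h1.deriv, ← inner_gradient, ← inner_orthPart (by rwa [inner_gradient])]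
  refine (abs_real_inner_le_norm _ _).trans ?_
  exact mul_le_of_le_one_right (norm_nonneg _) hγ.2

theorem fderiv_descentField (h : IsRadialConstraint J lam) {u : X} (hu : J u = lam) :
    fderiv ℝ J u (descentField J lam I u) = 0 := by
  rw [← inner_gradient, descentField, inner_neg_right, real_inner_smul_right, tangentialGradient,
    inner_left_orthPart (h.gradient_ne_zero hu), mul_zero, neg_zero]

theorem fderiv_radialExtension_descentField (h : IsRadialConstraint J lam) {u : X}
    (hu : J u = lam) : fderiv ℝ (radialExtension J lam I) u (descentField J lam I u) =
      -(1 / 2 * ‖tangentialGradient J lam I u‖) := by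
  have h1 : inner ℝ (gradient (radialExtension J lam I) u) (tangentialGradient J lam I u) =
      ‖tangentialGradient J lam I u‖ ^ 2 := by
    rw [← real_inner_self_eq_norm_sq]
    exact (inner_orthPart (inner_left_orthPart (h.gradient_ne_zero hu) _)).symm
  rw [← inner_gradient, descentField, inner_neg_right, real_inner_smul_right, h1]
  rcases eq_or_ne ‖tangentialGradient J lam I u‖ 0 with h0 | h0
  · simp [h0]
  · field_simp

theorem descentStep_zero (h : IsRadialConstraint J lam) {u : X} (hu : J u = lam) :
    descentStep J lam I 0 u = u := by
  rw [descentStep, zero_smul, add_zero, h.radialRetraction_eq_self hu]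

theorem descentField_neg (h : IsRadialConstraint J lam) (hIneg : ∀ u, J u = lam → I (-u) = I u)
    {u : X} (hu : J u = lam) : descentField J lam I (-u) = -descentField J lam I u := by
  have h1 : tangentialGradient J lam I (-u) = -tangentialGradient J lam I u := by
    rw [tangentialGradient, gradient_neg_of_even (Eventually.of_forall h.even),
      gradient_neg_of_even, orthPart_neg_neg, tangentialGradient]
    filter_upwards [h.eventually_radialRetraction_mem hu] with x hx
    rw [radialExtension, radialExtension, h.radialRetraction_neg, hIneg _ hx]
  rw [descentField, descentField, h1, norm_neg, smul_neg]

theorem descentStep_neg (h : IsRadialConstraint J lam) (hIneg : ∀ u, J u = lam → I (-u) = I u)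
    (s : ℝ) {u : X} (hu : J u = lam) : descentStep J lam I s (-u) = -descentStep J lam I s u := by
  rw [descentStep, descentStep, h.descentField_neg hIneg hu, smul_neg, ← neg_add,
    h.radialRetraction_neg]

/-- Short descent steps near a point where the differential is large. -/
theorem exists_isDescentStep (h : IsRadialConstraint J lam) (hI : IsC1On {x | J x = lam} I)
    {B : Set X} {a ε : ℝ} (hε : 0 < ε)
    (hB : ∀ u, J u = lam → u ∈ B → a < I u ∧ ENNReal.ofReal ε ≤ diffNorm {x | J x = lam} I u ∧
      ∀ᶠ w in 𝓝 u, J w = lam → w ∈ B)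
    {u : X} (hu : J u = lam) (huB : u ∈ B) :
    ∃ δ > 0, ∀ w ∈ {x | J x = lam}, dist w u < δ → ∀ s ∈ Icc (0 : ℝ) δ,
      IsDescentStep {x | J x = lam} I B a (ε / 4) (descentStep J lam I) w s := by
  have hgrad : ∀ w, J w = lam → w ∈ B → ε ≤ ‖tangentialGradient J lam I w‖ := fun w hw hwB =>
    (ENNReal.ofReal_le_ofReal_iff (norm_nonneg _)).1
      ((hB w hw hwB).2.1.trans (h.diffNorm_le_norm_tangentialGradient hI hw))
  have hne : ∀ w, J w = lam → w ∈ B → tangentialGradient J lam I w ≠ 0 := fun w hw hwB =>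
    norm_pos_iff.1 (hε.trans_le (hgrad w hw hwB))
  set V := descentField J lam I with hV
  have hVc : ContinuousAt V u := h.continuousAt_descentField hI hu (hne u hu huB)
  have hVle : ∀ w, ‖V w‖ ≤ 1 / 2 := norm_descentField_le J lam I
  have hπ := h.contDiffAt_radialRetraction hu
  have hΦ := h.contDiffAt_radialExtension hI hu
  set π := radialRetraction J lam with hπdef
  set Φ := radialExtension J lam I with hΦdef
  have hπu : π u = u := h.radialRetraction_eq_self hu
  -- Strict differentiability at `u` makes the first-order estimates uniform in the base point `w`
  -- near `u`.
  have hπs := (hπ.hasStrictFDerivAt one_ne_zero).isLittleO.bound (show (0 : ℝ) < 1 / 2 by norm_num)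
  have hΦs := (hΦ.hasStrictFDerivAt one_ne_zero).isLittleO.bound (show 0 < ε / 8 by positivity)
  have hmove : Tendsto (fun p : X × ℝ => p.1 + p.2 • V p.1) (𝓝 (u, 0)) (𝓝 u) := by
    have h1 : ContinuousAt (fun p : X × ℝ => V p.1) (u, 0) :=
      ContinuousAt.comp (f := Prod.fst) (g := V) hVc continuousAt_fst
    have h2 : ContinuousAt (fun p : X × ℝ => p.1 + p.2 • V p.1) (u, 0) :=
      continuousAt_fst.add (continuousAt_snd.smul h1)
    simpa using h2.tendsto
  have hfst : Tendsto (fun p : X × ℝ => p.1) (𝓝 (u, (0 : ℝ))) (𝓝 u) := continuousAt_fst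
  have hpair : Tendsto (fun p : X × ℝ => (p.1 + p.2 • V p.1, p.1)) (𝓝 (u, 0)) (𝓝 (u, u)) :=
    hmove.prodMk_nhds hfst
  have e1 := hpair.eventually hπs
  have e2 := hpair.eventually hΦs
  have e3 := hmove.eventually (h.eventually_radialRetraction_mem hu)
  have e4 := hmove.eventually (hΦ.continuousAt.eventually_const_lt
    (show a < Φ u by rw [hΦdef, h.radialExtension_eq hu]; exact (hB u hu huB).1))
  have e5 := hfst.eventually (hB u hu huB).2.2
  have hVu1 : fderiv ℝ π u (V u) = V u :=
    h.fderiv_radialRetraction_apply hu (h.fderiv_descentField hu)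
  have hVu2 : fderiv ℝ Φ u (V u) ≤ -(1 / 2 * ε) := by
    rw [h.fderiv_radialExtension_descentField hu]
    linarith [hgrad u hu huB]
  have e6 : ∀ᶠ p : X × ℝ in 𝓝 (u, 0), ‖fderiv ℝ π u (V p.1)‖ < 3 / 4 := by
    have : ContinuousAt (fun w => ‖fderiv ℝ π u (V w)‖) u :=
      ((fderiv ℝ π u).continuous.continuousAt.comp hVc).norm
    exact hfst.eventually (this.eventually_lt_const (by simp only [hVu1]; linarith [hVle u]))
  have e7 : ∀ᶠ p : X × ℝ in 𝓝 (u, 0), fderiv ℝ Φ u (V p.1) < -(3 / 8 * ε) := by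
    have : ContinuousAt (fun w => fderiv ℝ Φ u (V w)) u :=
      (fderiv ℝ Φ u).continuous.continuousAt.comp hVc
    exact hfst.eventually (this.eventually_lt_const (by linarith))
  have e8 : ∀ᶠ p : X × ℝ in 𝓝 (u, 0), ContinuousAt π (p.1 + p.2 • V p.1) := by
    refine hmove.eventually ((hπ.eventually (by simp)).mono fun x hx => hx.continuousAt)
  obtain ⟨δ, hδ, hball⟩ := Metric.eventually_nhds_iff_ball.1
    (e1.and (e2.and (e3.and (e4.and (e5.and (e6.and (e7.and e8)))))))
  refine ⟨δ / 2, half_pos hδ, fun w hw hwu s hs => ?_⟩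
  have hws : (w, s) ∈ Metric.ball (u, (0 : ℝ)) δ := by
    rw [Metric.mem_ball, Prod.dist_eq, Real.dist_eq, sub_zero, abs_of_nonneg hs.1]
    exact max_lt (by linarith) (by linarith [hs.2])
  obtain ⟨f1, f2, f3, f4, f5, f6, f7, f8⟩ := hball _ hws
  simp only [add_sub_cancel_left, map_smul, smul_eq_mul] at f1 f2
  have hwB : w ∈ B := f5 hw
  have hπw : π w = w := h.radialRetraction_eq_self hw
  have hΦw : Φ w = I w := h.radialExtension_eq hw
  have hnorm : ‖s • V w‖ ≤ s * (1 / 2) := by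
    rw [norm_smul, Real.norm_of_nonneg hs.1]
    exact mul_le_mul_of_nonneg_left (hVle w) hs.1
  have hIstep : I (descentStep J lam I s w) = Φ (w + s • V w) := rfl
  refine ⟨hwB, f3, ?_, ?_, ?_, ?_⟩
  · change dist (π (w + s • V w)) w ≤ s
    rw [dist_eq_norm]
    rw [hπw] at f1
    have h1 : ‖s • fderiv ℝ π u (V w)‖ ≤ s * (3 / 4) := by
      rw [norm_smul, Real.norm_of_nonneg hs.1]
      exact mul_le_mul_of_nonneg_left f6.le hs.1
    -- The linear part contributes at most `3/4 * s` and the remainder `1/2 * (s/2)`, in total `s`.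
    -- The length `1 / 2` of the field leaves room for this.
    have h2 := norm_le_norm_sub_add (π (w + s • V w) - w) (s • fderiv ℝ π u (V w))
    linarith
  · rw [hIstep]
    rw [hΦw, Real.norm_eq_abs] at f2
    -- The slope is at most `-3ε/8` and the remainder at most `ε/16` per unit of `s`, so the descent
    -- is at least `5ε/16`, more than the claimed `ε/4`.
    have h1 := (abs_le.1 f2).2
    have h2 : ε / 8 * ‖s • V w‖ ≤ ε / 8 * (s * (1 / 2)) :=
      mul_le_mul_of_nonneg_left hnorm (by positivity)
    have h3 : s * fderiv ℝ Φ u (V w) ≤ s * -(3 / 8 * ε) := mul_le_mul_of_nonneg_left f7.le hs.1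
    have h4 := mul_nonneg hs.1 hε.le
    linarith
  · rw [hIstep]
    exact f4.le
  · have hVw : ContinuousAt V w := h.continuousAt_descentField hI hw (hne w hw hwB)
    have h1 : ContinuousAt (fun p : ℝ × X => V p.2) (s, w) :=
      ContinuousAt.comp (f := Prod.snd) (g := V) hVw continuousAt_snd
    have h2 : ContinuousAt (fun p : ℝ × X => p.2 + p.1 • V p.2) (s, w) :=
      continuousAt_snd.add (continuousAt_fst.smul h1)
    exact (ContinuousAt.comp (f := fun p : ℝ × X => p.2 + p.1 • V p.2) (g := π) f8
      h2).continuousWithinAt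

end IsRadialConstraint

end Descent

/-! ### Minimax values and the gap argument. -/

section Minimax

variable {X : Type*} [NormedAddCommGroup X]

theorem neg_mem_cthickening {K : Set X} (hK : ∀ x ∈ K, -x ∈ K) (ρ : ℝ) :
    ∀ x ∈ Metric.cthickening ρ K, -x ∈ Metric.cthickening ρ K := by
  intro x hx
  have h1 : (fun y : X => -y) '' K = K := by
    refine Subset.antisymm (image_subset_iff.2 hK) fun y hy => ⟨-y, hK y hy, neg_neg y⟩
  have h2 : Metric.infEDist (-x) K = Metric.infEDist x K := by
    conv_lhs => rw [← h1]
    exact Metric.infEDist_image (Φ := fun y : X => -y)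
      (Isometry.of_dist_eq fun a b => dist_neg_neg a b)
  rwa [Metric.mem_cthickening_iff, h2, ← Metric.mem_cthickening_iff]

theorem neg_mem_thickening {K : Set X} (hK : ∀ x ∈ K, -x ∈ K) (ρ : ℝ) :
    ∀ x ∈ Metric.thickening ρ K, -x ∈ Metric.thickening ρ K := by
  intro x hx
  obtain ⟨z, hz, hd⟩ := Metric.mem_thickening_iff.1 hx
  exact Metric.mem_thickening_iff.2 ⟨-z, hK z hz, by rwa [dist_neg_neg]⟩

variable {M : Set X} {I : X → ℝ}

theorem minimaxValue_mono {j k : ℕ} (hjk : j ≤ k) : minimaxValue M I j ≤ minimaxValue M I k :=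
  biInf_mono fun _ hE => ⟨hE.1, (Nat.cast_le.2 hjk).trans hE.2⟩

theorem coe_le_minimaxValue {b : ℝ} (hb : ∀ v ∈ M, b ≤ I v) {k : ℕ} (hk : 1 ≤ k) :
    (b : EReal) ≤ minimaxValue M I k := by
  refine le_iInf₂ fun E hE => ?_
  have hne : E.Nonempty := by
    rw [nonempty_iff_ne_empty]
    rintro rfl
    have h1 := hE.2
    rw [genus_empty, nonpos_iff_eq_zero, Nat.cast_eq_zero] at h1
    omega
  obtain ⟨v, hv⟩ := hne
  exact (EReal.coe_le_coe_iff.2 (hb v (hE.1.1 hv))).trans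
    (le_iSup₂ (f := fun v (_ : v ∈ E) => (I v : EReal)) v hv)

theorem isClosed_of_mem_symClosed (hM : IsClosed M) {E : Set X} (hE : E ∈ symClosed M) :
    IsClosed E := by
  have h := hM.isClosedEmbedding_subtypeVal.isClosedMap _ hE.2.1
  rwa [Subtype.image_preimage_coe, inter_eq_right.2 hE.1] at h

namespace IsRadialConstraint

variable {X : Type*} [NormedAddCommGroup X] [InnerProductSpace ℝ X]
  {J : X → ℝ} {lam : ℝ} {I : X → ℝ}

theorem zero_notMem_critSet (h : IsRadialConstraint J lam) (c : ℝ) :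
    (0 : X) ∉ critSet {x | J x = lam} I c := fun h0 => h.zero_ne h0.1.1

theorem neg_mem_critSet (h : IsRadialConstraint J lam) (hIneg : ∀ u, J u = lam → I (-u) = I u)
    (c : ℝ) : ∀ u ∈ critSet {x | J x = lam} I c, -u ∈ critSet {x | J x = lam} I c :=
  fun _ hu => ⟨h.isCritPt_neg hIneg hu.1, (hIneg _ hu.1.1).trans hu.2⟩

theorem critSet_infinite (h : IsRadialConstraint J lam) {r : ℝ} {l : ℕ} (hl : 2 ≤ l)
    (hg : (l : ℕ∞) ≤ genus (critSet {x | J x = lam} I r)) :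
    (critSet {x | J x = lam} I r).Infinite := fun hfin => by
  have h1 := hg.trans (genus_le_one_of_finite hfin (h.zero_notMem_critSet r))
  have : l ≤ 1 := by exact_mod_cast h1
  omega

variable [CompleteSpace X]

/-- If the critical set of level `r` has genus at most `p`, then the minimax values jump over a
neighbourhood of `r` whenever the index increases by `p`. -/
theorem exists_minimaxValue_gap (h : IsRadialConstraint J lam) (hI : IsC1On {x | J x = lam} I)
    (hIneg : ∀ u, J u = lam → I (-u) = I u) {r : ℝ} (hPS : PalaisSmale {x | J x = lam} I r) {p : ℕ}
    (hp : genus (critSet {x | J x = lam} I r) ≤ p) :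
    ∃ ε > 0, ∀ k : ℕ, 1 ≤ k → ((r - ε : ℝ) : EReal) < minimaxValue {x | J x = lam} I k →
      ((r + ε : ℝ) : EReal) ≤ minimaxValue {x | J x = lam} I (k + p) := by
  set M := {x | J x = lam} with hM
  set K := critSet M I r with hK
  have hMc : IsClosed M := h.isClosed
  have hIc : ContinuousOn I M := h.continuousOn hI
  have hKneg : ∀ x ∈ K, -x ∈ K := h.neg_mem_critSet hIneg r
  obtain ⟨ρ, hρ, hgρ⟩ := exists_genus_cthickening_le (h.isCompact_critSet hI hPS) hKneg hp
  obtain ⟨ε₀, hε₀, hlow⟩ := h.exists_diffNorm_ge hI hPS (half_pos hρ)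
  -- The first bound keeps the levels in use inside the range of `hlow`. By the second, a descent
  -- from below `r + ε` to `r - ε` with slope `ε₀ / 4` travels at most `2ε / (ε₀ / 4) ≤ ρ / 4`.
  set ε := min (ε₀ / 2) (ε₀ * ρ / 32) with hε
  have hεpos : 0 < ε := lt_min (by positivity) (by positivity)
  have hεle : ε ≤ ε₀ / 2 := min_le_left _ _
  have hεle' : ε ≤ ε₀ * ρ / 32 := min_le_right _ _
  -- The intersection with `M` is needed for the symmetry of `B`, as `I` is known to be even only on
  -- `M`.
  set B : Set X := {u | r - ε < I u ∧ I u < r + ε₀ ∧ u ∉ Metric.cthickening (ρ / 2) K} ∩ M with hB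
  have hBspec : ∀ u, J u = lam → u ∈ B → r - ε < I u ∧ ENNReal.ofReal ε₀ ≤ diffNorm M I u ∧
      ∀ᶠ w in 𝓝 u, J w = lam → w ∈ B := by
    rintro u hu ⟨⟨h1, h2, h3⟩, -⟩
    refine ⟨h1, hlow u hu (abs_lt.2 ⟨by linarith, by linarith⟩)
      fun h4 => h3 (Metric.thickening_subset_cthickening _ _ h4), ?_⟩
    have e1 := (hIc u hu).eventually_const_lt h1
    have e2 := (hIc u hu).eventually_lt_const h2
    rw [eventually_nhdsWithin_iff] at e1 e2
    have e3 : ∀ᶠ w in 𝓝 u, w ∉ Metric.cthickening (ρ / 2) K :=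
      Metric.isClosed_cthickening.isOpen_compl.mem_nhds h3
    filter_upwards [e1, e2, e3] with w h4 h5 h6 hw
    exact ⟨⟨h4 hw, h5 hw, h6⟩, hw⟩
  have hBneg : ∀ u ∈ B, -u ∈ B := by
    rintro u ⟨⟨h1, h2, h3⟩, hu⟩
    refine ⟨⟨by rwa [hIneg u hu], by rwa [hIneg u hu], fun h4 => h3 ?_⟩, h.neg_mem u hu⟩
    simpa using neg_mem_cthickening hKneg _ _ h4
  obtain ⟨η, hη, hηA⟩ := exists_odd_deformation hMc.isComplete h.neg_mem hIc hIneg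
    (show 0 < ε₀ / 4 by positivity) (fun u hu => h.descentStep_zero hu)
    (fun s u hu => h.descentStep_neg hIneg s hu) hBneg
    (fun u hu huB => h.exists_isDescentStep hI hε₀ hBspec hu huB)
  refine ⟨ε, hεpos, fun k hk hck => ?_⟩
  by_contra! hlt
  obtain ⟨E, hE⟩ := iInf_lt_iff.1 hlt
  obtain ⟨hEΓ, hEsup⟩ := iInf_lt_iff.1 hE
  have hEI : ∀ u ∈ E, I u < r + ε := fun u hu => EReal.coe_lt_coe_iff.1
    ((le_iSup₂ (f := fun v (_ : v ∈ E) => (I v : EReal)) u hu).trans_lt hEsup)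
  set A := E \ Metric.thickening ρ K with hA
  have hAM : A ⊆ M := sdiff_subset.trans hEΓ.1.1
  have hEc : IsClosed E := isClosed_of_mem_symClosed hMc hEΓ.1
  have hAc : IsClosed A := hEc.sdiff Metric.isOpen_thickening
  have hAneg : ∀ u ∈ A, -u ∈ A := fun u hu =>
    ⟨hEΓ.1.2.2 u hu.1, fun h1 => hu.2 (by simpa using neg_mem_thickening hKneg ρ _ h1)⟩
  -- Points of `A` have distance at least `ρ` from `K` and move at most `ρ / 4`, so they stay off
  -- the `ρ / 2`-neighbourhood removed from `B`.
  obtain ⟨hηc, hηI⟩ := hηA A hAM (by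
    intro u hu w hw hd haw hIw
    have hIu := hEI u hu.1
    refine ⟨⟨haw, by linarith, fun hwK => hu.2 ?_⟩, hw⟩
    have hd' : dist w u ≤ ρ / 4 := by
      refine hd.trans ?_
      rw [div_le_iff₀ (by positivity)]
      nlinarith
    rw [Metric.mem_thickening_iff_infEDist_lt]
    rw [Metric.mem_cthickening_iff] at hwK
    have h1 : edist u w ≤ ENNReal.ofReal (ρ / 4) := by
      rw [edist_dist, dist_comm]
      exact ENNReal.ofReal_le_ofReal hd'
    calc Metric.infEDist u K ≤ edist u w + Metric.infEDist w K :=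
        Metric.infEDist_le_edist_add_infEDist
      _ ≤ ENNReal.ofReal (ρ / 4) + ENNReal.ofReal (ρ / 2) := add_le_add h1 hwK
      _ = ENNReal.ofReal (ρ / 4 + ρ / 2) :=
        (ENNReal.ofReal_add (by positivity) (by positivity)).symm
      _ < ENNReal.ofReal ρ := (ENNReal.ofReal_lt_ofReal_iff hρ).2 (by linarith))
  set D : Set X := {u ∈ M | I u ≤ r - ε} with hD
  have hDsym : D ∈ symClosed M := by
    refine ⟨fun u hu => hu.1, ?_, fun u hu => ⟨h.neg_mem u hu.1, by rw [hIneg u hu.1]; exact hu.2⟩⟩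
    have h1 : IsClosed {u : M | I u ≤ r - ε} :=
      isClosed_le (continuousOn_iff_continuous_domRestrict.1 hIc) continuous_const
    convert h1 using 1
    ext u
    exact and_iff_right u.2
  -- Otherwise `D` would compete in the definition of `c_k` and force `c_k ≤ r - ε`.
  have hDgenus : genus D < (k : ℕ∞) := by
    by_contra! h1
    have h2 : minimaxValue M I k ≤ ((r - ε : ℝ) : EReal) :=
      (iInf₂_le D ⟨hDsym, h1⟩).trans (iSup₂_le fun v hv => EReal.coe_le_coe_iff.2 hv.2)
    exact absurd hck (not_lt.2 h2)
  have hDgenus' : genus D ≤ ((k - 1 : ℕ) : ℕ∞) := by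
    refine Order.le_of_lt_add_one ?_
    have h1 : (((k - 1 : ℕ) : ℕ∞) + 1) = k := by
      rw [← Nat.cast_add_one, Nat.sub_add_cancel hk]
    rwa [h1]
  have hAgenus : genus A ≤ ((k - 1 : ℕ) : ℕ∞) :=
    (genus_le_of_odd_map (B := D) hηc fun u hu =>
      ⟨⟨(hη u (hAM hu)).1, hηI u hu⟩, (hη u (hAM hu)).2⟩).trans hDgenus'
  have hsub : E ⊆ A ∪ Metric.cthickening ρ K := fun u hu => by
    by_cases h1 : u ∈ Metric.thickening ρ K
    · exact Or.inr (Metric.thickening_subset_cthickening _ _ h1)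
    · exact Or.inl ⟨hu, h1⟩
  have hfin := (hEΓ.2.trans (genus_mono hsub)).trans (genus_union_le hAc Metric.isClosed_cthickening
    hAneg (neg_mem_cthickening hKneg ρ) hAgenus hgρ)
  have := Nat.cast_le.1 hfin
  omega

/-- If `l` consecutive minimax values equal `r`, then the critical set of level `r` has genus at
least `l`. -/
theorem le_genus_critSet (h : IsRadialConstraint J lam) (hI : IsC1On {x | J x = lam} I)
    (hIneg : ∀ u, J u = lam → I (-u) = I u) {r : ℝ} (hPS : PalaisSmale {x | J x = lam} I r)
    {k l : ℕ} (hk : 1 ≤ k) (hl : 1 ≤ l)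
    (hc : ∀ i < l, minimaxValue {x | J x = lam} I (k + i) = r) :
    (l : ℕ∞) ≤ genus (critSet {x | J x = lam} I r) := by
  by_contra! hlt
  have hle : genus (critSet {x | J x = lam} I r) ≤ ((l - 1 : ℕ) : ℕ∞) := by
    refine Order.le_of_lt_add_one ?_
    have h1 : (((l - 1 : ℕ) : ℕ∞) + 1) = l := by
      rw [← Nat.cast_add_one, Nat.sub_add_cancel hl]
    rwa [h1]
  obtain ⟨ε, hε, hgap⟩ := h.exists_minimaxValue_gap hI hIneg hPS hle
  have h0 := hc 0 (by omega)
  rw [add_zero] at h0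
  have h1 := hgap k hk (by rw [h0]; exact EReal.coe_lt_coe_iff.2 (by linarith))
  rw [hc (l - 1) (by omega), EReal.coe_le_coe_iff] at h1
  linarith

theorem critSet_nonempty (h : IsRadialConstraint J lam) (hI : IsC1On {x | J x = lam} I)
    (hIneg : ∀ u, J u = lam → I (-u) = I u) {r : ℝ} (hPS : PalaisSmale {x | J x = lam} I r)
    {k : ℕ} (hk : 1 ≤ k) (hc : minimaxValue {x | J x = lam} I k = r) :
    (critSet {x | J x = lam} I r).Nonempty := by
  have h1 := h.le_genus_critSet hI hIneg hPS hk le_rfl fun i hi => by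
    rwa [Nat.lt_one_iff.1 hi, add_zero]
  rw [nonempty_iff_ne_empty]
  intro h2
  rw [h2, genus_empty] at h1
  simp at h1

theorem tendsto_minimaxValue (h : IsRadialConstraint J lam) (hI : IsC1On {x | J x = lam} I)
    (hIneg : ∀ u, J u = lam → I (-u) = I u)
    (hPS : ∀ c < 0, PalaisSmale {x | J x = lam} I c)
    (hbot : ⊥ < minimaxValue {x | J x = lam} I 1)
    (hneg : ∀ k : ℕ, 1 ≤ k → minimaxValue {x | J x = lam} I k < 0) :
    Tendsto (minimaxValue {x | J x = lam} I) atTop (𝓝[<] 0) := by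
  set c := minimaxValue {x | J x = lam} I with hc
  refine tendsto_nhdsWithin_iff.2 ⟨?_, eventually_atTop.2 ⟨1, hneg⟩⟩
  have hmono : Monotone c := fun _ _ hjk => minimaxValue_mono hjk
  have hlim := tendsto_atTop_iSup hmono
  set L := ⨆ n, c n with hL
  have hle : ∀ n, c n ≤ L := le_iSup c
  -- The supremum includes the index `0`, where the empty set competes and `hneg` says nothing;
  -- passing to `n + 1` covers it.
  have hL0 : L ≤ 0 := iSup_le fun n => (hmono (Nat.le_succ n)).trans (hneg _ (by omega)).le
  rcases hL0.eq_or_lt with h0 | h0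
  · rwa [h0] at hlim
  exfalso
  have hLbot : L ≠ ⊥ := (hbot.trans_le (hle 1)).ne'
  have hLtop : L ≠ ⊤ := (h0.trans EReal.zero_lt_top).ne
  lift L to ℝ using ⟨hLtop, hLbot⟩ with r hr
  have hr0 : r < 0 := by exact_mod_cast h0
  obtain ⟨p, hp⟩ := exists_genus_le_of_isCompact (h.isCompact_critSet hI (hPS r hr0))
    (h.zero_notMem_critSet r)
  obtain ⟨ε, hε, hgap⟩ := h.exists_minimaxValue_gap hI hIneg (hPS r hr0) hp
  obtain ⟨k, hk1, hk⟩ := ((hlim.eventually_const_lt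
    (show ((r - ε : ℝ) : EReal) < r from EReal.coe_lt_coe_iff.2 (by linarith))).and
      (eventually_ge_atTop 1)).exists
  have h1 := (hgap k hk hk1).trans (hle (k + p))
  rw [EReal.coe_le_coe_iff] at h1
  linarith

/-- The Lusternik-Schnirelmann theorem below the level `0` for an even `C¹` function on a radial
constraint set. -/
theorem lusternik_schnirelmann (h : IsRadialConstraint J lam) {M : Set X}
    (hM : M = {x | J x = lam}) (hI : IsC1On M I) (hIneg : ∀ u ∈ M, I (-u) = I u)
    (hbdd : ∃ b : ℝ, ∀ v ∈ M, b ≤ I v) (hPS : ∀ c : ℝ, c < 0 → PalaisSmale M I c) {c : ℕ → EReal}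
    (hc : ∀ k, c k = minimaxValue M I k) :
    (⊥ < c 1 ∧ (∀ j k : ℕ, 1 ≤ j → j ≤ k → c j ≤ c k) ∧
      ∀ k : ℕ, 1 ≤ k → c k < 0 → (∃ r : ℝ, c k = r ∧ IsCritValue M I r) ∧
        ∀ j : ℕ, 1 ≤ j → j ≤ k → c j < 0) ∧
    (∀ (k l : ℕ) (r : ℝ), 1 ≤ k → 1 ≤ l → r < 0 → (∀ i : ℕ, i < l → c (k + i) = r) →
      (l : ℕ∞) ≤ genus (critSet M I r) ∧ (2 ≤ l → (critSet M I r).Infinite)) ∧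
    ((∀ k : ℕ, 1 ≤ k → c k < 0) → Tendsto c atTop (𝓝[<] (0 : EReal))) := by
  subst hM
  obtain rfl : c = minimaxValue {x | J x = lam} I := funext hc
  have hbot : ⊥ < minimaxValue {x | J x = lam} I 1 := by
    obtain ⟨b, hb⟩ := hbdd
    exact (EReal.bot_lt_coe b).trans_le (coe_le_minimaxValue hb le_rfl)
  refine ⟨⟨hbot, fun j k _ hjk => minimaxValue_mono hjk, fun k hk hneg => ⟨?_,
    fun j _ hjk => (minimaxValue_mono hjk).trans_lt hneg⟩⟩,
    fun k l r hk hl hr hkl => ?_, h.tendsto_minimaxValue hI hIneg hPS hbot⟩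
  · obtain ⟨r, hr⟩ : ∃ r : ℝ, (r : EReal) = minimaxValue {x | J x = lam} I k :=
      ⟨_, EReal.coe_toReal (hneg.trans EReal.zero_lt_top).ne
        (hbot.trans_le (minimaxValue_mono hk)).ne'⟩
    rw [← hr] at hneg
    exact ⟨r, hr.symm, h.critSet_nonempty hI hIneg (hPS r (by exact_mod_cast hneg)) hk hr.symm⟩
  · have hg := h.le_genus_critSet hI hIneg (hPS r hr) hk hl hkl
    exact ⟨hg, fun h2 => h.critSet_infinite h2 hg⟩

end IsRadialConstraint

end Minimax

/-! ### Pointwise estimates for `f ^ 2`. -/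

section DualSquare

/-- The derivative of `f ^ 2`. -/
def dualSqDeriv (t : ℝ) : ℝ := 2 * dualF t / Real.sqrt (1 + 2 * dualF t ^ 2)

theorem hasDerivAt_dualF_sq (t : ℝ) :
    HasDerivAt (fun t => dualF t ^ 2) (dualSqDeriv t) t := by
  refine ((dualF_hasDerivAt t).fun_pow 2).congr_deriv ?_
  simp only [dualSqDeriv]
  ring

theorem hasDerivAt_dualSqDeriv (t : ℝ) :
    HasDerivAt dualSqDeriv (2 / (1 + 2 * dualF t ^ 2) ^ 2) t := by
  have hpos : 0 < 1 + 2 * dualF t ^ 2 := by positivity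
  have hs := sqrt_one_add_pos (dualF t)
  have hf := dualF_hasDerivAt t
  have h1 := ((((hf.fun_pow 2).const_mul 2).const_add 1).sqrt hpos.ne')
  refine ((hf.const_mul 2).div h1 hs.ne').congr_deriv ?_
  have hsq := Real.sq_sqrt hpos.le
  set s := Real.sqrt (1 + 2 * dualF t ^ 2)
  rw [← hsq]
  field_simp
  linear_combination hsq

theorem dualF_zero : dualF 0 = 0 := by
  have := dualF_neg 0
  rw [neg_zero] at this
  linarith

theorem dualSqDeriv_zero : dualSqDeriv 0 = 0 := by simp [dualSqDeriv, dualF_zero]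

theorem lipschitzWith_dualF : LipschitzWith 1 dualF := by
  refine lipschitzWith_of_nnnorm_deriv_le (fun t => (dualF_hasDerivAt t).differentiableAt)
    fun t => ?_
  rw [← NNReal.coe_le_coe, coe_nnnorm, (dualF_hasDerivAt t).deriv, Real.norm_eq_abs,
    abs_of_pos (one_div_pos.2 (sqrt_one_add_pos _)), NNReal.coe_one,
    div_le_one (sqrt_one_add_pos _)]
  exact Real.one_le_sqrt.2 (by nlinarith [sq_nonneg (dualF t)])

/-- The second derivative of `f ^ 2` is `2 / (1 + 2 f²)²`, at most `2`. This gives both the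
quadratic Taylor bound and a Nemytskii operator continuous on `L²`. -/
theorem lipschitzWith_dualSqDeriv : LipschitzWith 2 dualSqDeriv := by
  refine lipschitzWith_of_nnnorm_deriv_le (fun t => (hasDerivAt_dualSqDeriv t).differentiableAt)
    fun t => ?_
  rw [← NNReal.coe_le_coe, coe_nnnorm, (hasDerivAt_dualSqDeriv t).deriv, Real.norm_eq_abs,
    abs_of_pos (by positivity)]
  refine div_le_self zero_le_two ?_
  exact one_le_pow₀ (by nlinarith [sq_nonneg (dualF t)])

theorem dualF_strictMono : StrictMono dualF := dualIso.symm.strictMono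

theorem dualSqDeriv_mul_pos {t : ℝ} (ht : t ≠ 0) : 0 < dualSqDeriv t * t := by
  have h : 0 < dualF t * t := by
    rcases ht.lt_or_gt with h | h
    · exact mul_pos_of_neg_of_neg (by simpa [dualF_zero] using dualF_strictMono h) h
    · exact mul_pos (by simpa [dualF_zero] using dualF_strictMono h) h
  rw [dualSqDeriv, div_mul_eq_mul_div, mul_assoc]
  exact div_pos (by linarith) (sqrt_one_add_pos _)

theorem dualF_sq_le (t : ℝ) : dualF t ^ 2 ≤ t ^ 2 := by
  have h := lipschitzWith_dualF.dist_le_mul t 0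
  rw [dualF_zero, Real.dist_0_eq_abs, Real.dist_0_eq_abs, NNReal.coe_one, one_mul] at h
  exact sq_le_sq.2 h

theorem abs_dualF_sq_sub_le (t h : ℝ) :
    |dualF (t + h) ^ 2 - dualF t ^ 2 - dualSqDeriv t * h| ≤ 2 * h ^ 2 := by
  have hd : ∀ y ∈ segment ℝ t (t + h), HasDerivWithinAt (fun x => dualF x ^ 2 - dualSqDeriv t * x)
      (dualSqDeriv y - dualSqDeriv t) (segment ℝ t (t + h)) y := fun y _ => by
    have := (hasDerivAt_dualF_sq y).sub ((hasDerivAt_id y).const_mul (dualSqDeriv t))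
    rw [mul_one] at this
    exact this.hasDerivWithinAt
  have hb : ∀ y ∈ segment ℝ t (t + h), ‖dualSqDeriv y - dualSqDeriv t‖ ≤ 2 * |h| := fun y hy => by
    rw [← dist_eq_norm]
    refine (lipschitzWith_dualSqDeriv.dist_le_mul y t).trans ?_
    have h1 : dist y t ≤ |h| := by
      rw [segment_eq_uIcc] at hy
      have := abs_sub_left_of_mem_uIcc hy
      rwa [add_sub_cancel_left] at this
    rw [NNReal.coe_ofNat]
    linarith
  have := (convex_segment t (t + h)).norm_image_sub_le_of_norm_hasDerivWithin_le hd hb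
    (left_mem_segment ℝ t (t + h)) (right_mem_segment ℝ t (t + h))
  rw [Real.norm_eq_abs, Real.norm_eq_abs, add_sub_cancel_left, mul_assoc, abs_mul_abs_self] at this
  calc _ = _ := by congr 1; ring
    _ ≤ _ := this
    _ = _ := by ring

end DualSquare

theorem inner_real_eq_mul (a b : ℝ) : inner ℝ a b = a * b := by simp [mul_comm]

/-! ### The mass functional on `L²` as a radial constraint. -/

section Functional

variable {α : Type*} [MeasurableSpace α] {μ : Measure α}

/-- The functional `∫ f(u)²` on `L²`. -/
def dualMass (u : Lp ℝ 2 μ) : ℝ := ∫ x, dualF (u x) ^ 2 ∂μ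

/-- The Nemytskii operator of the derivative of `f ^ 2`: the gradient of `dualMass`. -/
def dualMassGradient (u : Lp ℝ 2 μ) : Lp ℝ 2 μ :=
  lipschitzWith_dualSqDeriv.compLp dualSqDeriv_zero u

theorem integrable_dualF_sq (u : Lp ℝ 2 μ) : Integrable (fun x => dualF (u x) ^ 2) μ := by
  refine (Lp.memLp u).integrable_sq.mono
    ((lipschitzWith_dualF.continuous.pow 2).comp_aestronglyMeasurable
      (Lp.aestronglyMeasurable u)) (Eventually.of_forall fun x => ?_)
  rw [Real.norm_of_nonneg (sq_nonneg _), Real.norm_of_nonneg (sq_nonneg _)]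
  exact dualF_sq_le _

theorem coeFn_dualMassGradient (u : Lp ℝ 2 μ) :
    ∀ᵐ x ∂μ, dualMassGradient u x = dualSqDeriv (u x) :=
  lipschitzWith_dualSqDeriv.coeFn_compLp dualSqDeriv_zero u

theorem inner_dualMassGradient (u h : Lp ℝ 2 μ) :
    inner ℝ (dualMassGradient u) h = ∫ x, dualSqDeriv (u x) * h x ∂μ := by
  rw [L2.inner_def]
  refine integral_congr_ae ?_
  filter_upwards [coeFn_dualMassGradient u] with x hx
  rw [hx, inner_real_eq_mul]

theorem integrable_dualSqDeriv_mul (u h : Lp ℝ 2 μ) :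
    Integrable (fun x => dualSqDeriv (u x) * h x) μ := by
  refine (L2.integrable_inner (𝕜 := ℝ) (dualMassGradient u) h).congr ?_
  filter_upwards [coeFn_dualMassGradient u] with x hx
  rw [hx, inner_real_eq_mul]

theorem norm_sq_eq_integral (h : Lp ℝ 2 μ) : ‖h‖ ^ 2 = ∫ x, h x ^ 2 ∂μ := by
  rw [← real_inner_self_eq_norm_sq, L2.inner_def]
  refine integral_congr_ae (Eventually.of_forall fun x => ?_)
  simp only [inner_real_eq_mul, sq]

/-- Integrating the pointwise Taylor bound gives a remainder of at most `2 * ‖h‖ ^ 2`. -/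
theorem hasFDerivAt_dualMass (u : Lp ℝ 2 μ) :
    HasFDerivAt dualMass (innerSL ℝ (dualMassGradient u)) u := by
  rw [hasFDerivAt_iff_isLittleO_nhds_zero]
  have hbound : ∀ h : Lp ℝ 2 μ,
      ‖dualMass (u + h) - dualMass u - innerSL ℝ (dualMassGradient u) h‖ ≤ 2 * ‖‖h‖ ^ 2‖ := by
    intro h
    rw [innerSL_apply_apply, inner_dualMassGradient, dualMass, dualMass,
      ← integral_sub (integrable_dualF_sq _) (integrable_dualF_sq _),
      ← integral_sub (f := fun x => dualF ((u + h) x) ^ 2 - dualF (u x) ^ 2)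
        ((integrable_dualF_sq _).sub (integrable_dualF_sq _)) (integrable_dualSqDeriv_mul u h),
      Real.norm_of_nonneg (sq_nonneg ‖h‖), norm_sq_eq_integral, ← integral_const_mul]
    refine norm_integral_le_of_norm_le ((Lp.memLp h).integrable_sq.const_mul 2) ?_
    filter_upwards [Lp.coeFn_add u h] with x hx
    rw [hx]
    exact abs_dualF_sq_sub_le _ _
  refine (Asymptotics.IsBigO.of_bound 2 (Eventually.of_forall hbound)).trans_isLittleO ?_
  exact Asymptotics.isLittleO_norm_pow_id one_lt_two

theorem contDiff_dualMass : ContDiff ℝ 1 (dualMass : Lp ℝ 2 μ → ℝ) := by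
  rw [contDiff_one_iff_fderiv]
  refine ⟨fun u => (hasFDerivAt_dualMass u).differentiableAt, ?_⟩
  have : fderiv ℝ (dualMass : Lp ℝ 2 μ → ℝ) = fun u => innerSL ℝ (dualMassGradient u) :=
    funext fun u => (hasFDerivAt_dualMass u).fderiv
  rw [this]
  exact (innerSL ℝ).continuous.comp (lipschitzWith_dualSqDeriv.continuous_compLp dualSqDeriv_zero)

theorem dualMass_neg (u : Lp ℝ 2 μ) : dualMass (-u) = dualMass u := by
  refine integral_congr_ae ?_
  filter_upwards [Lp.coeFn_neg u] with x hx
  rw [hx, Pi.neg_apply, dualF_neg, neg_sq]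

theorem dualMass_zero : dualMass (0 : Lp ℝ 2 μ) = 0 := by
  rw [dualMass, ← integral_zero α ℝ (μ := μ)]
  refine integral_congr_ae ?_
  filter_upwards [Lp.coeFn_zero ℝ 2 μ] with x hx
  rw [hx, Pi.zero_apply, dualF_zero]
  norm_num

theorem fderiv_dualMass_self_pos {u : Lp ℝ 2 μ} (hu : u ≠ 0) : 0 < fderiv ℝ dualMass u u := by
  rw [(hasFDerivAt_dualMass u).fderiv, innerSL_apply_apply, inner_dualMassGradient]
  have hnonneg : ∀ x, 0 ≤ dualSqDeriv (u x) * u x := fun x => by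
    rcases eq_or_ne (u x) 0 with h | h
    · rw [h, mul_zero]
    · exact (dualSqDeriv_mul_pos h).le
  refine (integral_nonneg hnonneg).lt_of_ne' fun h0 => hu ?_
  rw [integral_eq_zero_iff_of_nonneg hnonneg (integrable_dualSqDeriv_mul u u)] at h0
  rw [Lp.eq_zero_iff_ae_eq_zero]
  filter_upwards [h0] with x hx
  by_contra h
  exact (dualSqDeriv_mul_pos h).ne' hx

theorem isRadialConstraint_dualMass {lam : ℝ} (hlam : 0 < lam) :
    IsRadialConstraint (dualMass : Lp ℝ 2 μ → ℝ) lam where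
  contDiff := contDiff_dualMass
  even := dualMass_neg
  zero_ne := by rw [dualMass_zero]; exact hlam.ne
  pos _ hu := fderiv_dualMass_self_pos hu

/-- Transfers the constraint from `L²` to the Sobolev workspace; injectivity keeps nonzero vectors
nonzero, so the radial derivative stays positive. -/
theorem IsRadialConstraint.comp_injective {X Y : Type*} [NormedAddCommGroup X] [NormedSpace ℝ X]
    [NormedAddCommGroup Y] [NormedSpace ℝ Y] {J : X → ℝ} {lam : ℝ} (h : IsRadialConstraint J lam)
    (L : Y →L[ℝ] X) (hL : Function.Injective L) : IsRadialConstraint (fun y => J (L y)) lam where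
  contDiff := h.contDiff.comp L.contDiff
  even v := by rw [map_neg, h.even]
  zero_ne := by rw [map_zero]; exact h.zero_ne
  pos v hv := by
    have h1 : HasFDerivAt (fun y => J (L y)) ((fderiv ℝ J (L v)).comp L) v :=
      (h.hasFDerivAt (L v)).comp v L.hasFDerivAt
    rw [h1.fderiv]
    exact h.pos (L v) ((map_ne_zero_iff L hL).2 hv)

end Functional

/-! ### Completeness of `H¹` and its inclusion into `L²`. -/

section Sobolev

variable {E : Type*} [NormedAddCommGroup E] [InnerProductSpace ℝ E] [FiniteDimensional ℝ E]
  [MeasurableSpace E] [BorelSpace E]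

theorem isClosed_H1 : IsClosed (H1 E : Set (WithLp 2 (Lp ℝ 2 (volume : Measure E) ×
    Lp E 2 (volume : Measure E)))) := by
  have h : (H1 E : Set (WithLp 2 (Lp ℝ 2 (volume : Measure E) × Lp E 2 (volume : Measure E)))) =
      ⋂ (φ : E → ℝ) (_ : ContDiff ℝ ∞ φ) (_ : HasCompactSupport φ) (e : E),
        {w | ∫ x, w.fst x * fderiv ℝ φ x e = -∫ x, inner ℝ (w.snd x) e * φ x} := by
    ext w
    simp only [mem_iInter]
    rfl
  rw [h]
  refine isClosed_iInter fun φ => isClosed_iInter fun hφ => isClosed_iInter fun hc =>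
    isClosed_iInter fun e => ?_
  have hφ2 : MemLp (fun x => φ x • e) 2 (volume : Measure E) :=
    (hφ.continuous.smul continuous_const).memLp_of_hasCompactSupport hc.smul_right
  have hd2 : MemLp (fun x => fderiv ℝ φ x e) 2 (volume : Measure E) :=
    ((hφ.continuous_fderiv (by simp)).clm_apply continuous_const).memLp_of_hasCompactSupport
      (hc.fderiv_apply (𝕜 := ℝ) e)
  have h1 : ∀ u : Lp ℝ 2 (volume : Measure E),
      ∫ x, u x * fderiv ℝ φ x e = inner ℝ (hd2.toLp _) u := fun u => by
    rw [L2.inner_def]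
    refine integral_congr_ae ?_
    filter_upwards [hd2.coeFn_toLp] with x hx
    rw [hx, inner_real_eq_mul, mul_comm]
  have h2 : ∀ g : Lp E 2 (volume : Measure E),
      ∫ x, inner ℝ (g x) e * φ x = inner ℝ (hφ2.toLp _) g := fun g => by
    rw [L2.inner_def]
    refine integral_congr_ae ?_
    filter_upwards [hφ2.coeFn_toLp] with x hx
    rw [hx, real_inner_smul_left, mul_comm, real_inner_comm]
  simp only [h1, h2]
  refine isClosed_eq ?_ ?_
  · exact continuous_const.inner (WithLp.continuous_fst 2 _ _)
  · exact (continuous_const.inner (WithLp.continuous_snd 2 _ _)).neg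

instance : CompleteSpace (H1 E) := isClosed_H1.completeSpace_coe

/-- The inclusion of `H¹` into `L²`. -/
def H1.toL2 : H1 E →L[ℝ] Lp ℝ 2 (volume : Measure E) :=
  (WithLp.fstL 2 ℝ (Lp ℝ 2 (volume : Measure E)) (Lp E 2 (volume : Measure E))).comp (H1 E).subtypeL

/-- The weak gradient is determined by the function. -/
theorem H1.toL2_injective : Function.Injective (H1.toL2 (E := E)) := by
  refine (injective_iff_map_eq_zero _).2 fun v hv => ?_
  have hfst : v.1.fst = 0 := hv
  have hsnd : v.1.snd = 0 := by
    rw [Lp.eq_zero_iff_ae_eq_zero]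
    have hloc : LocallyIntegrable (v.1.snd : E → E) volume :=
      (Lp.memLp v.1.snd).locallyIntegrable one_le_two
    -- When the function vanishes, integration by parts makes its weak gradient orthogonal to all
    -- test functions, so the fundamental lemma applies.
    refine ae_eq_zero_of_integral_contDiff_smul_eq_zero hloc fun φ hφ hc => ?_
    have hint : Integrable (fun x => φ x • v.1.snd x) volume :=
      hloc.integrable_smul_left_of_hasCompactSupport hφ.continuous hc
    refine ext_inner_left ℝ fun e => ?_
    rw [inner_zero_right, ← integral_inner hint]
    have h1 := v.2 φ hφ hc e
    have h2 : ∫ x, v.1.fst x * fderiv ℝ φ x e = 0 := by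
      rw [hfst]
      refine integral_eq_zero_of_ae ?_
      filter_upwards [Lp.coeFn_zero ℝ 2 (volume : Measure E)] with x hx
      rw [hx, Pi.zero_apply, zero_mul]
    rw [h2, eq_comm, neg_eq_zero] at h1
    rw [← h1]
    refine integral_congr_ae (Eventually.of_forall fun x => ?_)
    simp only [real_inner_smul_right]
    rw [mul_comm, real_inner_comm]
  refine Subtype.ext ((WithLp.ofLp_injective 2) (Prod.ext hfst hsnd))

/-- Composition with `g` is an isometry of `L²`, so equivariance is an equation between two
continuous maps. -/
theorem H1.isClosed_equivariant (g : E ≃ₗᵢ[ℝ] E) (s : ℝ) :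
    IsClosed (H1.equivariant g s : Set (H1 E)) := by
  have h : (H1.equivariant g s : Set (H1 E)) = {v | Lp.compMeasurePreservingₗᵢ ℝ g
      g.measurePreserving (H1.toL2 v) = s • H1.toL2 v} := by
    ext v
    have h1 := Lp.coeFn_compMeasurePreserving (H1.toL2 v) g.measurePreserving
    have h2 := Lp.coeFn_smul s (H1.toL2 v)
    constructor
    · intro hv
      refine Lp.ext ?_
      filter_upwards [h1, h2, H1.mem_equivariant.1 hv] with x e1 e2 e3
      rw [e2]
      exact e1.trans e3
    · intro hv
      refine H1.mem_equivariant.2 ?_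
      have h3 : ∀ᵐ x, Lp.compMeasurePreserving g g.measurePreserving (H1.toL2 v) x =
          (s • H1.toL2 v) x := by
        have hv' : Lp.compMeasurePreserving g g.measurePreserving (H1.toL2 v) =
          s • H1.toL2 v := hv
        rw [hv']
        exact Eventually.of_forall fun _ => rfl
      filter_upwards [h1, h2, h3] with x e1 e2 e3
      exact (e1.symm.trans e3).trans e2
  rw [h]
  exact isClosed_eq ((LinearIsometry.continuous _).comp H1.toL2.continuous)
    (H1.toL2.continuous.const_smul s)

end Sobolev

/-! ### The symmetric space as a Hilbert space carrying the constraint. -/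

section SymmetricSpace

variable {N m : ℕ}

theorem isClosed_YG : IsClosed (YG N m : Set (H1 (RN N m))) := by
  simp only [YG, Submodule.coe_inf, Submodule.coe_iInf]
  exact (isClosed_iInter fun g => isClosed_iInter fun _ => H1.isClosed_equivariant g 1).inter
    (H1.isClosed_equivariant _ _)

instance : CompleteSpace (YG N m) := isClosed_YG.completeSpace_coe

variable (N m) in
/-- The inclusion of `𝐘_𝐆` into `L²`. -/
def YG.toL2 : YG N m →L[ℝ] Lp ℝ 2 (volume : Measure (RN N m)) :=
  (H1.toL2 (E := RN N m)).comp (YG N m).subtypeL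

theorem YG.toL2_injective : Function.Injective (YG.toL2 N m) :=
  H1.toL2_injective.comp Subtype.val_injective

theorem isRadialConstraint_YG {lam : ℝ} (hlam : 0 < lam) :
    IsRadialConstraint (fun v : YG N m => dualMass (YG.toL2 N m v)) lam := by
  have h := @IsRadialConstraint.comp_injective (Lp ℝ 2 (volume : Measure (RN N m))) (YG N m)
    inferInstance inferInstance inferInstance inferInstance
  exact h (isRadialConstraint_dualMass hlam) (YG.toL2 N m) YG.toL2_injective

end SymmetricSpace

end NonradialQLS

end

theorem theorem3p2 (N m : ℕ) (hN : 4 ≤ N) (hm : 2 ≤ m) (hmN : 2 * m ≤ N) (hNm : N - 2 * m ≠ 1)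
    (lam : ℝ) (hlam : 0 < lam)
    (I : NonradialQLS.YG N m → ℝ)
    (hC1 : NonradialQLS.IsC1On (NonradialQLS.Ycon N m lam) I)
    (heven : ∀ v ∈ NonradialQLS.Ycon N m lam, I (-v) = I v)
    (hbdd : ∃ b : ℝ, ∀ v ∈ NonradialQLS.Ycon N m lam, b ≤ I v)
    (hPS : ∀ c : ℝ, c < 0 → NonradialQLS.PalaisSmale (NonradialQLS.Ycon N m lam) I c)
    (hGamma : ∀ k : ℕ, 1 ≤ k → (NonradialQLS.genusFamily (NonradialQLS.Ycon N m lam) k).Nonempty)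
    (c : ℕ → EReal)
    (hc : ∀ k : ℕ, c k = NonradialQLS.minimaxValue (NonradialQLS.Ycon N m lam) I k) :
    -- (i)
    (⊥ < c 1 ∧ (∀ j k : ℕ, 1 ≤ j → j ≤ k → c j ≤ c k) ∧
      ∀ k : ℕ, 1 ≤ k → c k < 0 →
        (∃ r : ℝ, c k = r ∧ NonradialQLS.IsCritValue (NonradialQLS.Ycon N m lam) I r) ∧
          ∀ j : ℕ, 1 ≤ j → j ≤ k → c j < 0) ∧
    -- (ii)
    (∀ (k l : ℕ) (r : ℝ), 1 ≤ k → 1 ≤ l → r < 0 → (∀ i : ℕ, i < l → c (k + i) = r) →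
      (l : ℕ∞) ≤ NonradialQLS.genus (NonradialQLS.critSet (NonradialQLS.Ycon N m lam) I r) ∧
        (2 ≤ l → (NonradialQLS.critSet (NonradialQLS.Ycon N m lam) I r).Infinite)) ∧
    -- (iii)
    ((∀ k : ℕ, 1 ≤ k → c k < 0) → Tendsto c atTop (𝓝[<] (0 : EReal))) := by
  have h := @NonradialQLS.IsRadialConstraint.lusternik_schnirelmann (NonradialQLS.YG N m)
    inferInstance inferInstance
  -- By definition `Ycon` is the level set of `dualMass` composed with the inclusion into `L²`,
  -- hence `rfl`.
  exact h (NonradialQLS.isRadialConstraint_YG hlam) rfl hC1 heven hbdd hPS hc
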